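/- For $u\in\mathbb{R}$ let $$\Phi(u)=\sum_{n=1}^\infty\left(2\pi^2n^4e^{9u}-3\pi n^2e^{5u}\right)\exp\left(-\pi n^2e^{4u}\right),$$ and for $t\in\mathbb{R}$, $z\in\mathbb{C}$ let $$H_t(z)=\int_0^\infty e^{tu^2}\,\Phi(u)\cos(zu)\,du .$$ Let $\Lambda$ be the de Bruijn–Newman constant, that is, the infimum (in $[-\infty,\infty]$) of the set of all $t\in\mathbb{R}$ for which all the zeros of $H_t$ are real. **Theorem (Upper bound criterion).** Let $t_0,X>0$ and $0<y_0\le 1$ be real numbers such that: (i) there are no zeros $\zeta(\sigma+iT)=0$ of the Riemann zeta function with $\frac{1+y_0}{2}\le\sigma\le 1$ and $0\le T\le\frac X2$; (ii) there are no zeros $H_{t_0}(x+iy)=0$ with $x\ge X+\sqrt{1-y_0^2}$ and $y_0\le y\le\sqrt{1-2t_0}$; (iii) there are no zeros $H_t(x+iy)=0$ with $X\le x\le X+\sqrt{1-y_0^2}$, $\sqrt{y_0^2+2(t_0-t)}\le y\le\sqrt{1-2t}$ and $0\le t\le t_0$. (If $1-2t_0<0$, respectively $1-2t<0$, the corresponding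 range of $y$ is empty.) Then $\Lambda\le t_0+\frac12y_0^2$, and all the zeros of $H_t$ are real for every $t\ge t_0+\frac12y_0^2$. -/

import Mathlib

namespace DeBruijnNewman

/-- The super-exponentially decaying function
`Φ(u) = ∑_{n ≥ 1} (2 π² n⁴ e^{9u} - 3 π n² e^{5u}) exp(-π n² e^{4u})`;
the summation index `n : ℕ` is shifted by one. -/
noncomputable def Phi (u : ℝ) : ℝ :=
  ∑' n : ℕ, (2 * Real.pi ^ 2 * ((n : ℝ) + 1) ^ 4 * Real.exp (9 * u)
      - 3 * Real.pi * ((n : ℝ) + 1) ^ 2 * Real.exp (5 * u))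
    * Real.exp (-Real.pi * ((n : ℝ) + 1) ^ 2 * Real.exp (4 * u))

/-- The heat flow evolution `H_t(z) = ∫_0^∞ e^{t u²} Φ(u) cos(z u) du` of the Riemann
`ξ` function, for a real time `t` and a complex argument `z`. -/
noncomputable def H (t : ℝ) (z : ℂ) : ℂ :=
  ∫ u in Set.Ioi (0 : ℝ), ((Real.exp (t * u ^ 2) * Phi u : ℝ) : ℂ) * Complex.cos (z * (u : ℂ))

/-- All the zeros of the entire function `H_t` are real. -/
def OnlyRealZeros (t : ℝ) : Prop :=
  ∀ z : ℂ, H t z = 0 → z.im = 0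

/-- The de Bruijn-Newman constant: the infimum of the times `t` at which all the zeros of `H_t`
are real. It is taken in the extended reals, so that no convention on infima of empty or
unbounded sets of reals enters. -/
noncomputable def Lambda : EReal :=
  sInf ((fun t : ℝ => (t : EReal)) '' {t : ℝ | OnlyRealZeros t})

end DeBruijnNewman

open MeasureTheory Set Filter Topology

/-! The heat flow is discretised. Multiplying a kernel by `cosh (l * u)` replaces its cosine
transform `f` by the average of `f (z + i l)` and `f (z - i l)`. If `n * l ^ 2 = 2 * T`, then `cosh
(l * u) ^ n` approximates `exp (T * u ^ 2)`, so `n` averagings approximate the flow over time `T`,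
and `hurwitz` carries zero-free open sets to the limit.

One averaging step is controlled by a modulus comparison. The average vanishes at `x + i y`, `y >
0`, only if `f` has equal moduli at `x + i (y ± l)`. A Hadamard product, paired over `ρ` and its
conjugate, makes the upper modulus strictly larger as soon as every zero `a + i b` satisfies `b ^ 2
< (x - a) ^ 2 + y ^ 2 + l ^ 2` (`cosTransform_cosh_ne_zero`). If `D` bounds the squared heights of
all zeros, one step lowers `D` by `l ^ 2`; in the limit this is de Bruijn's theorem
(`sq_im_le_of_exp`).

The same comparison localises (`sq_im_le_of_barrier`). At time `t` the zeros with `|a| ≤ X + w`, `w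
^ 2 = 1 - y₀ ^ 2`, should have squared height at most `y₀ ^ 2 + 2 * (t₀ - t)`. Zeros beyond the
barrier have squared height at most `max (1 - 2 * t) 0`, and are too far from `|x| ≤ X` to violate
the criterion there; the barrier hypothesis covers `X ≤ |x| ≤ X + w`. At time `0` the bound comes
from zeta through Riemann's formula (`cosTransform_Phi_eq`). With the final hypothesis, all zeros at
time `t₀` have height at most `y₀`, and de Bruijn's theorem makes them real after a further time `y₀
^ 2 / 2`. -/

namespace DeBruijnNewman

/-! ### Rapidly decaying kernels and their cosine transforms -/

/-- Kernels on the half line that are positive and decay faster than every Gaussian. -/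
structure RapidKernel (K : ℝ → ℝ) : Prop where
  pos : ∀ u, 0 < u → 0 < K u
  integrable : ∀ c : ℝ, IntegrableOn (fun u => K u * Real.exp (c * u ^ 2)) (Ioi 0)

/-- The cosine transform of a kernel on the half line. -/
noncomputable def cosTransform (K : ℝ → ℝ) (z : ℂ) : ℂ :=
  ∫ u in Ioi (0 : ℝ), ((K u : ℝ) : ℂ) * Complex.cos (z * (u : ℂ))

lemma exp_mul_le (B u : ℝ) : Real.exp (B * u) ≤ Real.exp (B ^ 2) * Real.exp (1 * u ^ 2) := by
  rw [← Real.exp_add]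
  apply Real.exp_le_exp.2
  nlinarith [sq_nonneg (B - u), sq_nonneg B, sq_nonneg u]

lemma norm_cos_le (w : ℂ) : ‖Complex.cos w‖ ≤ Real.exp |w.im| := by
  rw [Complex.cos, norm_div]
  have h1 : ‖Complex.exp (w * Complex.I)‖ ≤ Real.exp |w.im| := by
    rw [Complex.norm_exp]; apply Real.exp_le_exp.2; simp [neg_le_abs]
  have h2 : ‖Complex.exp (-w * Complex.I)‖ ≤ Real.exp |w.im| := by
    rw [Complex.norm_exp]; apply Real.exp_le_exp.2; simp [le_abs_self]
  have := norm_add_le (Complex.exp (w * Complex.I)) (Complex.exp (-w * Complex.I))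
  simp only [Complex.norm_ofNat]
  linarith

lemma norm_sin_le (w : ℂ) : ‖Complex.sin w‖ ≤ Real.exp |w.im| := by
  rw [Complex.sin, norm_div, norm_mul, Complex.norm_I, mul_one]
  have h1 : ‖Complex.exp (w * Complex.I)‖ ≤ Real.exp |w.im| := by
    rw [Complex.norm_exp]; apply Real.exp_le_exp.2; simp [neg_le_abs]
  have h2 : ‖Complex.exp (-w * Complex.I)‖ ≤ Real.exp |w.im| := by
    rw [Complex.norm_exp]; apply Real.exp_le_exp.2; simp [le_abs_self]
  have := norm_sub_le (Complex.exp (-w * Complex.I)) (Complex.exp (w * Complex.I))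
  simp only [Complex.norm_ofNat]
  linarith

lemma norm_cos_mul_le (z : ℂ) {u : ℝ} (hu : 0 < u) :
    ‖Complex.cos (z * u)‖ ≤ Real.exp (|z.im| * u) := by
  have := norm_cos_le (z * u)
  simpa [abs_mul, abs_of_pos hu] using this

lemma norm_sin_mul_le (z : ℂ) {u : ℝ} (hu : 0 < u) :
    ‖Complex.sin (z * u)‖ ≤ Real.exp (|z.im| * u) := by
  have := norm_sin_le (z * u)
  simpa [abs_mul, abs_of_pos hu] using this

namespace RapidKernel

variable {K : ℝ → ℝ}

lemma aestronglyMeasurable (hK : RapidKernel K) :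
    AEStronglyMeasurable K (volume.restrict (Ioi 0)) := by
  simpa using (hK.integrable 0).aestronglyMeasurable

lemma integrableOn_smul {E : Type*} [NormedAddCommGroup E] [NormedSpace ℝ E]
    [SecondCountableTopology E] (hK : RapidKernel K) {g : ℝ → E}
    (hg : Continuous g) {C c : ℝ} (hb : ∀ u, 0 < u → ‖g u‖ ≤ C * Real.exp (c * u ^ 2)) :
    IntegrableOn (fun u => K u • g u) (Ioi 0) := by
  refine Integrable.mono' ((hK.integrable c).const_mul C)
    (hK.aestronglyMeasurable.smul hg.aestronglyMeasurable) ?_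
  filter_upwards [ae_restrict_mem measurableSet_Ioi] with u hu
  rw [norm_smul, Real.norm_of_nonneg (hK.pos u hu).le]
  calc K u * ‖g u‖ ≤ K u * (C * Real.exp (c * u ^ 2)) :=
        mul_le_mul_of_nonneg_left (hb u hu) (hK.pos u hu).le
    _ = _ := by ring

lemma integrableOn_mul_ofReal (hK : RapidKernel K) {g : ℝ → ℂ}
    (hg : Continuous g) {C c : ℝ} (hb : ∀ u, 0 < u → ‖g u‖ ≤ C * Real.exp (c * u ^ 2)) :
    IntegrableOn (fun u => ((K u : ℝ) : ℂ) * g u) (Ioi 0) := by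
  simpa using hK.integrableOn_smul hg hb

lemma mul (hK : RapidKernel K) {g : ℝ → ℝ} (hg : Continuous g) (hpos : ∀ u, 0 < u → 0 < g u)
    {C c : ℝ} (hb : ∀ u, 0 < u → g u ≤ C * Real.exp (c * u ^ 2)) :
    RapidKernel (fun u => K u * g u) := by
  refine ⟨fun u hu => mul_pos (hK.pos u hu) (hpos u hu), fun d => ?_⟩
  have := hK.integrableOn_smul (g := fun u => g u * Real.exp (d * u ^ 2)) (C := C) (c := c + d)
    (by fun_prop) (fun u hu => by
      rw [norm_mul, Real.norm_of_nonneg (hpos u hu).le, Real.norm_of_nonneg (Real.exp_pos _).le,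
        add_mul, Real.exp_add, ← mul_assoc]
      exact mul_le_mul_of_nonneg_right (hb u hu) (Real.exp_pos _).le)
  simpa [mul_assoc] using this

lemma mul_exp (hK : RapidKernel K) (c : ℝ) : RapidKernel (fun u => K u * Real.exp (c * u ^ 2)) :=
  hK.mul (C := 1) (c := c) (by fun_prop) (fun u _ => Real.exp_pos _) (fun u _ => by simp)

/-- Keeps every stage of the discrete flow in the class, because `cosh x ≤ exp (x ^ 2 / 2)`. -/
lemma mul_cosh_pow (hK : RapidKernel K) (l : ℝ) (k : ℕ) :
    RapidKernel (fun u => K u * Real.cosh (l * u) ^ k) := by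
  refine hK.mul (C := 1) (c := k * (l ^ 2 / 2)) (by fun_prop)
    (fun u _ => pow_pos (Real.cosh_pos _) _) (fun u _ => ?_)
  calc Real.cosh (l * u) ^ k ≤ Real.exp ((l * u) ^ 2 / 2) ^ k :=
        pow_le_pow_left₀ (Real.cosh_pos _).le (Real.cosh_le_exp_half_sq _) _
    _ = _ := by rw [← Real.exp_nat_mul, one_mul]; congr 1; ring

lemma integral_pos (hK : RapidKernel K) : 0 < ∫ u in Ioi (0 : ℝ), K u := by
  have hi : IntegrableOn K (Ioi 0) := by simpa using hK.integrable 0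
  rw [setIntegral_pos_iff_support_of_nonneg_ae _ hi]
  · have : Function.support K ∩ Ioi 0 = Ioi 0 := by
      ext u
      simp only [mem_inter_iff, Function.mem_support, mem_Ioi, and_iff_right_iff_imp]
      exact fun hu => (hK.pos u hu).ne'
    rw [this]; simp
  · filter_upwards [ae_restrict_mem measurableSet_Ioi] with u hu using (hK.pos u hu).le

lemma integrableOn_cos (hK : RapidKernel K) (z : ℂ) :
    IntegrableOn (fun u : ℝ => ((K u : ℝ) : ℂ) * Complex.cos (z * u)) (Ioi 0) :=
  hK.integrableOn_mul_ofReal (by fun_prop)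
    (fun u hu => (norm_cos_mul_le z hu).trans (exp_mul_le _ _))

/-- Completing the square gives `‖z‖ * u ≤ ε * ‖z‖ ^ 2 + u ^ 2 / (4 * ε)`, and the kernel absorbs
the Gaussian in `u`. -/
lemma norm_cosTransform_le (hK : RapidKernel K) {ε : ℝ} (hε : 0 < ε) :
    ∃ C : ℝ, ∀ z, ‖cosTransform K z‖ ≤ C * Real.exp (ε * ‖z‖ ^ 2) := by
  refine ⟨∫ u in Ioi (0 : ℝ), K u * Real.exp (1 / (4 * ε) * u ^ 2), fun z => ?_⟩
  rw [← integral_mul_const]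
  refine norm_integral_le_of_norm_le ((hK.integrable _).mul_const _) ?_
  filter_upwards [ae_restrict_mem measurableSet_Ioi] with u hu
  have hu : 0 < u := hu
  rw [norm_mul, Complex.norm_real, Real.norm_of_nonneg (hK.pos u hu).le, mul_assoc, ← Real.exp_add]
  refine mul_le_mul_of_nonneg_left ((norm_cos_mul_le z hu).trans (Real.exp_le_exp.2 ?_))
    (hK.pos u hu).le
  have h1 : |z.im| * u ≤ ‖z‖ * u := mul_le_mul_of_nonneg_right (Complex.abs_im_le_norm z) hu.le
  have h2 : 0 ≤ (2 * ε * ‖z‖ - u) ^ 2 / (4 * ε) := by positivity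
  have h3 : (2 * ε * ‖z‖ - u) ^ 2 / (4 * ε) = 1 / (4 * ε) * u ^ 2 + ε * ‖z‖ ^ 2 - ‖z‖ * u := by
    field_simp; ring
  linarith

lemma differentiable_cosTransform (hK : RapidKernel K) : Differentiable ℂ (cosTransform K) := by
  intro z₀
  have hb : ∀ u : ℝ, 0 < u → ‖u * Real.exp ((|z₀.im| + 1) * u)‖ ≤
      Real.exp ((|z₀.im| + 2) ^ 2) * Real.exp (1 * u ^ 2) := by
    intro u hu
    refine le_trans ?_ (exp_mul_le _ _)
    rw [Real.norm_of_nonneg (by positivity)]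
    calc u * Real.exp ((|z₀.im| + 1) * u) ≤ Real.exp u * Real.exp ((|z₀.im| + 1) * u) := by
          gcongr; linarith [Real.add_one_le_exp u]
      _ = _ := by rw [← Real.exp_add]; congr 1; ring
  have key := hasDerivAt_integral_of_dominated_loc_of_deriv_le (μ := volume.restrict (Ioi (0 : ℝ)))
    (F := fun (z : ℂ) (u : ℝ) => ((K u : ℝ) : ℂ) * Complex.cos (z * u))
    (F' := fun (z : ℂ) (u : ℝ) => ((K u : ℝ) : ℂ) * (-Complex.sin (z * u) * u))
    (x₀ := z₀) (bound := fun u => K u * (u * Real.exp ((|z₀.im| + 1) * u)))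
    (Metric.ball_mem_nhds z₀ one_pos)
    (Eventually.of_forall fun z => (hK.integrableOn_cos z).aestronglyMeasurable)
    (hK.integrableOn_cos z₀) ?_ ?_ ?_ ?_
  · exact key.2.differentiableAt
  · exact (Complex.continuous_ofReal.comp_aestronglyMeasurable hK.aestronglyMeasurable).mul
      (Continuous.aestronglyMeasurable (by fun_prop))
  · filter_upwards [ae_restrict_mem measurableSet_Ioi] with u hu z hz
    have hu : 0 < u := hu
    rw [norm_mul, Complex.norm_real, Real.norm_of_nonneg (hK.pos u hu).le]
    refine mul_le_mul_of_nonneg_left ?_ (hK.pos u hu).le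
    rw [norm_mul, norm_neg, Complex.norm_real, Real.norm_of_nonneg hu.le, mul_comm]
    refine mul_le_mul_of_nonneg_left ((norm_sin_mul_le z hu).trans (Real.exp_le_exp.2 ?_)) hu.le
    refine mul_le_mul_of_nonneg_right ?_ hu.le
    have h1 : |(z - z₀).im| ≤ ‖z - z₀‖ := Complex.abs_im_le_norm _
    have h2 : ‖z - z₀‖ < 1 := by simpa [dist_eq_norm] using hz
    have h3 : |z.im| ≤ |z₀.im| + |(z - z₀).im| := by
      have := abs_add_le z₀.im (z - z₀).im
      simpa using this
    linarith
  · have := hK.integrableOn_smul (g := fun u => u * Real.exp ((|z₀.im| + 1) * u)) (by fun_prop) hb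
    simpa [IntegrableOn] using this
  · refine Eventually.of_forall fun u z _ => ?_
    have h := ((hasDerivAt_id z).mul_const (u : ℂ)).ccos.const_mul ((K u : ℝ) : ℂ)
    simpa using h

end RapidKernel

lemma cosTransform_neg (K : ℝ → ℝ) (z : ℂ) : cosTransform K (-z) = cosTransform K z := by
  simp [cosTransform]

lemma cosTransform_conj (K : ℝ → ℝ) (z : ℂ) :
    cosTransform K (starRingEnd ℂ z) = starRingEnd ℂ (cosTransform K z) := by
  rw [cosTransform, cosTransform, ← integral_conj]
  refine integral_congr_ae (Eventually.of_forall fun u => ?_)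
  simp only [map_mul, Complex.conj_ofReal, ← Complex.cos_conj]

lemma cosTransform_zero (K : ℝ → ℝ) :
    cosTransform K 0 = ((∫ u in Ioi (0 : ℝ), K u : ℝ) : ℂ) := by
  rw [cosTransform, ← integral_complex_ofReal]; simp

/-- The addition formula for the cosine turns a discrete heat step into a vertical average. -/
lemma cosTransform_mul_cosh {K : ℝ → ℝ} (hK : RapidKernel K) (l : ℝ) (z : ℂ) :
    cosTransform (fun u => K u * Real.cosh (l * u)) z =
      (cosTransform K (z + l * Complex.I) + cosTransform K (z - l * Complex.I)) / 2 := by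
  rw [cosTransform, cosTransform, cosTransform, ← integral_add (hK.integrableOn_cos _)
    (hK.integrableOn_cos _), ← integral_div]
  refine integral_congr_ae (Eventually.of_forall fun u => ?_)
  simp only
  rw [add_mul, sub_mul, Complex.cos_add, Complex.cos_sub,
    show (l : ℂ) * Complex.I * u = ((l * u : ℝ) : ℂ) * Complex.I by push_cast; ring,
    Complex.cos_mul_I]
  push_cast
  ring

lemma RapidKernel.cosTransform_zero_ne {K : ℝ → ℝ} (hK : RapidKernel K) :
    cosTransform K 0 ≠ 0 := by
  rw [cosTransform_zero]
  exact_mod_cast hK.integral_pos.ne'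

/-- Excludes constant transforms, and so guarantees a zero in the modulus comparison: `cos (i u) =
cosh u > 1` and the kernel is positive. -/
lemma RapidKernel.cosTransform_I_ne {K : ℝ → ℝ} (hK : RapidKernel K) :
    cosTransform K Complex.I ≠ cosTransform K 0 := by
  have h1 : cosTransform K Complex.I = cosTransform (fun u => K u * Real.cosh u) 0 := by
    rw [cosTransform, cosTransform]
    refine integral_congr_ae (Eventually.of_forall fun u => ?_)
    simp [mul_comm Complex.I, Complex.cos_mul_I]
  have hc : RapidKernel (fun u => K u * Real.cosh u) := by simpa using hK.mul_cosh_pow 1 1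
  have hd : RapidKernel (fun u => K u * (Real.cosh u - 1)) := by
    refine hK.mul (C := 1) (c := 1 / 2) (by fun_prop)
      (fun u hu => sub_pos.2 (Real.one_lt_cosh.2 hu.ne')) (fun u _ => ?_)
    have := Real.cosh_le_exp_half_sq u
    rw [one_mul, one_div_mul_eq_div]
    linarith
  rw [h1, cosTransform_zero, cosTransform_zero]
  have hi : IntegrableOn K (Ioi 0) := by simpa using hK.integrable 0
  have hi' : IntegrableOn (fun u => K u * Real.cosh u) (Ioi 0) := by simpa using hc.integrable 0
  have := hd.integral_pos
  simp only [mul_sub, mul_one] at this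
  rw [integral_sub hi' hi] at this
  exact_mod_cast (sub_pos.1 this).ne'

/-! ### Approximate Hadamard factorization -/

/-- The radius `3 * R` is chosen so that dividing out zeros of modulus at most `R` only decreases
the function on the large circle, and each division gains a factor 2. -/
lemma norm_factor_ge {R : ℝ} {ρ w : ℂ} (hρ0 : ρ ≠ 0) (hρ : ‖ρ‖ ≤ R)
    (hw : ‖w‖ = 3 * R) : 2 ≤ ‖1 - w / ρ‖ := by
  have h1 : 3 ≤ ‖w / ρ‖ := by
    rw [norm_div, hw, le_div_iff₀ (norm_pos_iff.2 hρ0)]; nlinarith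
  have h2 := norm_sub_norm_le (w / ρ) 1
  rw [norm_sub_rev, norm_one] at h2
  linarith

lemma norm_prod_factor_ge {R : ℝ} (s : Multiset ℂ)
    (hs : ∀ ρ ∈ s, ρ ≠ 0 ∧ ‖ρ‖ ≤ R) {w : ℂ} (hw : ‖w‖ = 3 * R) :
    2 ^ s.card ≤ ‖(s.map fun ρ => 1 - w / ρ).prod‖ := by
  induction s using Multiset.induction_on with
  | empty => simp
  | cons a s ih =>
    have h1 := ih fun ρ hρ => hs ρ (Multiset.mem_cons_of_mem hρ)
    have h2 := norm_factor_ge (hs a (Multiset.mem_cons_self a s)).1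
      (hs a (Multiset.mem_cons_self a s)).2 hw
    rw [Multiset.map_cons, Multiset.prod_cons, norm_mul, Multiset.card_cons, pow_succ, mul_comm]
    gcongr

lemma exists_factor {g : ℂ → ℂ} (hg : Differentiable ℂ g) {ρ : ℂ} (hρ : g ρ = 0) (hρ0 : ρ ≠ 0) :
    ∃ q : ℂ → ℂ, Differentiable ℂ q ∧ ∀ w, g w = (1 - w / ρ) * q w := by
  have hd : DifferentiableOn ℂ (dslope g ρ) univ :=
    (Complex.differentiableOn_dslope univ_mem).2 hg.differentiableOn
  refine ⟨fun w => -ρ * dslope g ρ w,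
    fun w => ((differentiableOn_univ.1 hd) w).const_mul _, fun w => ?_⟩
  have := sub_smul_dslope g ρ w
  rw [hρ, sub_zero, smul_eq_mul] at this
  rw [← this]; field_simp; ring

/-- A bound on the cofactor of a polynomial in an entire function. -/
lemma cofactor_le {f g : ℂ → ℂ} (hg : Differentiable ℂ g)
    {R M : ℝ} (hR : 0 < R) (hM : ∀ w, ‖w‖ = 3 * R → ‖f w‖ ≤ M) (s : Multiset ℂ)
    (hs : ∀ ρ ∈ s, ρ ≠ 0 ∧ ‖ρ‖ ≤ R)
    (hfg : ∀ w, f w = (s.map fun ρ => 1 - w / ρ).prod * g w) {w : ℂ} (hw : ‖w‖ ≤ 3 * R) :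
    2 ^ s.card * ‖g w‖ ≤ M := by
  rw [mul_comm, ← le_div_iff₀ (by positivity)]
  have h3 : (3 * R) ≠ 0 := by positivity
  refine Complex.norm_le_of_forall_mem_frontier_norm_le (U := Metric.ball (0 : ℂ) (3 * R))
    Metric.isBounded_ball hg.diffContOnCl ?_ ?_
  · intro z hz
    rw [frontier_ball _ h3] at hz
    have hz' : ‖z‖ = 3 * R := by simpa using hz
    rw [le_div_iff₀ (by positivity), mul_comm]
    calc 2 ^ s.card * ‖g z‖ ≤ ‖(s.map fun ρ => 1 - z / ρ).prod‖ * ‖g z‖ := by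
          gcongr; exact norm_prod_factor_ge s hs hz'
      _ = ‖f z‖ := by rw [hfg z, norm_mul]
      _ ≤ M := hM z hz'
  · rw [closure_ball _ h3]; simpa using hw

/-- Division of an entire function by the polynomial of its zeros in a disc. -/
lemma exists_zeros_factorization {f : ℂ → ℂ} (hf : Differentiable ℂ f) (hf0 : f 0 ≠ 0)
    {R M : ℝ} (hR : 0 < R) (hM : ∀ w, ‖w‖ = 3 * R → ‖f w‖ ≤ M) :
    ∃ (s : Multiset ℂ) (g : ℂ → ℂ), Differentiable ℂ g ∧
      (∀ ρ ∈ s, f ρ = 0 ∧ ρ ≠ 0 ∧ ‖ρ‖ ≤ R) ∧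
      (∀ w, f w = (s.map fun ρ => 1 - w / ρ).prod * g w) ∧
      (∀ w, ‖w‖ ≤ R → g w ≠ 0) ∧ ∀ w, ‖w‖ ≤ 3 * R → ‖g w‖ ≤ M := by
  let P : ℕ → Prop := fun n => ∃ (s : Multiset ℂ) (g : ℂ → ℂ), s.card = n ∧ Differentiable ℂ g ∧
      (∀ ρ ∈ s, f ρ = 0 ∧ ρ ≠ 0 ∧ ‖ρ‖ ≤ R) ∧
      (∀ w, f w = (s.map fun ρ => 1 - w / ρ).prod * g w)
  have hP0 : P 0 := ⟨0, f, by simp, hf, by simp, by simp⟩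
  obtain ⟨N, hN⟩ := pow_unbounded_of_one_lt (M / ‖f 0‖) (one_lt_two : (1 : ℝ) < 2)
  -- The cofactor equals `f 0` at the origin, so `2 ^ n * ‖f 0‖ ≤ M` limits how many zeros can be
  -- divided out. A maximal choice therefore leaves none in the disc, with multiplicities accounted
  -- for.
  have hbound : ∀ n, P n → n < N := by
    rintro n ⟨s, g, rfl, hg, hs, hfg⟩
    have h1 := cofactor_le hg hR hM s (fun ρ hρ => (hs ρ hρ).2) hfg
      (w := 0) (by simpa using hR.le)
    have h2 : f 0 = g 0 := by rw [hfg 0]; simp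
    rw [← h2, ← le_div_iff₀ (norm_pos_iff.2 hf0)] at h1
    exact (pow_lt_pow_iff_right₀ one_lt_two).1 (h1.trans_lt hN)
  classical
  have hmax := Nat.findGreatest_spec (P := P) (Nat.zero_le N) hP0
  obtain ⟨s, g, hcard, hg, hs, hfg⟩ := hmax
  refine ⟨s, g, hg, hs, hfg, fun w hw hgw => ?_, fun w hw => ?_⟩
  · have hw0 : w ≠ 0 := by
      rintro rfl; apply hf0; rw [hfg, hgw, mul_zero]
    obtain ⟨q, hq, hgq⟩ := exists_factor hg hgw hw0
    have hP : P (Nat.findGreatest P N + 1) := by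
      refine ⟨w ::ₘ s, q, by simp [hcard], hq, ?_, fun z => ?_⟩
      · intro ρ hρ
        rcases Multiset.mem_cons.1 hρ with rfl | h
        · exact ⟨by rw [hfg, hgw, mul_zero], hw0, hw⟩
        · exact hs ρ h
      · rw [hfg z, hgq z, Multiset.map_cons, Multiset.prod_cons]; ring
    have := Nat.le_findGreatest (hbound _ hP).le hP
    omega
  · have h1 := cofactor_le hg hR hM s (fun ρ hρ => (hs ρ hρ).2) hfg hw
    have h2 : (1 : ℝ) ≤ 2 ^ s.card := one_le_pow₀ one_le_two
    nlinarith [norm_nonneg (g w)]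

/-- Holomorphic logarithm of a zero-free function on a disc around the origin. -/
lemma exists_log_on_ball {g : ℂ → ℂ} (hg : Differentiable ℂ g) {R : ℝ} (hR : 0 < R)
    (h0 : ∀ w, ‖w‖ ≤ R → g w ≠ 0) :
    ∃ k : ℂ → ℂ, DifferentiableOn ℂ k (Metric.ball 0 R) ∧ k 0 = 0 ∧
      ∀ w ∈ Metric.ball (0 : ℂ) R, g w = g 0 * Complex.exp (k w) := by
  have hne : ∀ w ∈ Metric.ball (0 : ℂ) R, g w ≠ 0 := fun w hw => h0 w (by
    rw [mem_ball_zero_iff] at hw; exact hw.le)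
  have hd : DifferentiableOn ℂ (fun w => deriv g w / g w) (Metric.ball 0 R) :=
    DifferentiableOn.div (hg.deriv.differentiableOn) hg.differentiableOn hne
  obtain ⟨k₀, hk₀⟩ := hd.isExactOn_ball
  have hk : ∀ w ∈ Metric.ball (0 : ℂ) R,
      HasDerivAt (fun z => k₀ z - k₀ 0) (deriv g w / g w) w := fun w hw => (hk₀ w hw).sub_const _
  refine ⟨fun z => k₀ z - k₀ 0, fun w hw => (hk w hw).differentiableAt.differentiableWithinAt,
    by simp, fun w hw => ?_⟩
  have hconst : ∀ z ∈ Metric.ball (0 : ℂ) R,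
      HasDerivAt (fun z => g z * Complex.exp (-(k₀ z - k₀ 0))) 0 z := by
    intro z hz
    have e : g z * (deriv g z / g z) = deriv g z := mul_div_cancel₀ _ (hne z hz)
    refine ((hg z).hasDerivAt.mul (hk z hz).neg.cexp).congr_deriv ?_
    linear_combination -Complex.exp (-(k₀ z - k₀ 0)) * e
  have h := (convex_ball (0 : ℂ) R).is_const_of_fderivWithin_eq_zero (𝕜 := ℂ)
    (f := fun z => g z * Complex.exp (-(k₀ z - k₀ 0)))
    (fun z hz => (hconst z hz).differentiableAt.differentiableWithinAt) (fun z hz => by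
      rw [fderivWithin_of_isOpen Metric.isOpen_ball hz]
      rw [(hconst z hz).hasFDerivAt.fderiv]; ext; simp) hw (Metric.mem_ball_self hR)
  simp only [sub_self, neg_zero, Complex.exp_zero, mul_one] at h
  rw [← h, mul_assoc, ← Complex.exp_add]; simp

/-- An even function bounded on a disc and vanishing at the centre vanishes to second order. -/
lemma norm_even_le {m : ℂ → ℂ} {r A : ℝ} (hr : 0 < r)
    (hm : DifferentiableOn ℂ m (Metric.ball 0 r)) (h0 : m 0 = 0) (heven : ∀ w, m (-w) = m w)
    (hA : ∀ w ∈ Metric.ball (0 : ℂ) r, ‖m w‖ ≤ A) {w : ℂ} (hw : w ∈ Metric.ball (0 : ℂ) r) :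
    ‖m w‖ ≤ A * (‖w‖ / r) ^ 2 := by
  have hd : HasDerivAt m (deriv m 0) 0 :=
    (hm.differentiableAt (Metric.ball_mem_nhds 0 hr)).hasDerivAt
  have hd0 : deriv m 0 = 0 := by
    have h1 : HasDerivAt m (deriv m 0) (-(0 : ℂ)) := by simpa using hd
    have h2 := HasDerivAt.comp (0 : ℂ) h1 (hasDerivAt_neg (0 : ℂ))
    have h3 : m ∘ Neg.neg = m := funext heven
    rw [h3] at h2
    have h4 := h2.unique hd
    have h5 : (2 : ℂ) * deriv m 0 = 0 := by linear_combination -h4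
    simpa using h5
  rw [hd0] at hd
  have key := Complex.dist_le_mul_div_pow_of_mapsTo_ball_of_isLittleO (n := 1) (R₂ := A) hm
    (fun z hz => by simpa [h0] using hA z hz) (by
      have := hd.isLittleO
      simpa using this.norm_right) hw
  simpa [h0] using key

lemma borelCaratheodory_half {k : ℂ → ℂ} {R A : ℝ} (hR : 0 < R) (hA : 0 < A)
    (hk : DifferentiableOn ℂ k (Metric.ball 0 R)) (hk0 : k 0 = 0)
    (hre : ∀ w ∈ Metric.ball (0 : ℂ) R, (k w).re ≤ A) {w : ℂ}
    (hw : w ∈ Metric.ball (0 : ℂ) (R / 2)) : ‖k w‖ ≤ 2 * A := by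
  have hw' : ‖w‖ < R / 2 := by simpa using hw
  have h := Complex.borelCaratheodory_zero hA hk hre hR (z := w) (by simp; linarith) hk0
  refine h.trans ?_
  rw [div_le_iff₀ (by linarith)]
  nlinarith

/-- Approximate Hadamard factorization of `f w * f (-w)` for an entire function of growth
`exp (o (‖w‖ ^ 2))`. -/
lemma exists_approx_factorization {f : ℂ → ℂ} (hf : Differentiable ℂ f) (hf0 : f 0 ≠ 0)
    (hgrowth : ∀ ε : ℝ, 0 < ε → ∃ C : ℝ, ∀ z, ‖f z‖ ≤ C * Real.exp (ε * ‖z‖ ^ 2))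
    (B : ℝ) {δ : ℝ} (hδ : 0 < δ) :
    ∃ s : Multiset ℂ, (∀ ρ ∈ s, f ρ = 0 ∧ ρ ≠ 0) ∧ (∀ ρ, f ρ = 0 → ‖ρ‖ ≤ B → ρ ∈ s) ∧
      ∀ w, ‖w‖ ≤ B → ∃ m : ℂ, ‖m‖ ≤ δ ∧
        f w * f (-w) = f 0 ^ 2 *
          (s.map fun ρ => (1 - w / ρ) * (1 + w / ρ)).prod * Complex.exp m := by
  wlog hB : 1 ≤ B generalizing B
  · obtain ⟨s, h1, h2, h3⟩ := this 1 le_rfl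
    push Not at hB
    exact ⟨s, h1, fun ρ h h' => h2 ρ h (h'.trans hB.le), fun w hw => h3 w (hw.trans hB.le)⟩
  -- The final error is `16 * A * B ^ 2 / R ^ 2` with `A = L + 9 * ε * R ^ 2`. This `ε` makes the
  -- second part `δ / 2`, and `R` is then taken large enough for the first.
  set ε : ℝ := δ / (288 * B ^ 2) with hεdef
  have hε : 0 < ε := by positivity
  obtain ⟨C, hC⟩ := hgrowth ε hε
  have hC0 : 0 < C := by
    have := hC 0
    simp only [norm_zero, ne_eq, OfNat.ofNat_ne_zero, not_false_eq_true, zero_pow, mul_zero,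
      Real.exp_zero, mul_one] at this
    exact (norm_pos_iff.2 hf0).trans_le this
  have hf0' : 0 < ‖f 0‖ := norm_pos_iff.2 hf0
  set L : ℝ := |Real.log (C / ‖f 0‖)| with hL
  have hL0 : 0 ≤ L := abs_nonneg _
  obtain ⟨R, hR⟩ : ∃ R : ℝ, 2 * B < R ∧ 32 * B ^ 2 * L ≤ δ * R ^ 2 := by
    refine ⟨2 * B + 1 + 32 * B ^ 2 * L / δ, ?_, ?_⟩
    · have : 0 ≤ 32 * B ^ 2 * L / δ := by positivity
      linarith
    · have h1 : 0 ≤ 32 * B ^ 2 * L / δ := by positivity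
      have h2 : 32 * B ^ 2 * L / δ ≤ (2 * B + 1 + 32 * B ^ 2 * L / δ) ^ 2 := by nlinarith
      calc 32 * B ^ 2 * L = δ * (32 * B ^ 2 * L / δ) := by field_simp
        _ ≤ _ := by gcongr
  have hR0 : 0 < R := by linarith [hR.1]
  have hM : ∀ w : ℂ, ‖w‖ = 3 * R → ‖f w‖ ≤ C * Real.exp (ε * (3 * R) ^ 2) := by
    intro w hw; rw [← hw]; exact hC w
  obtain ⟨s, g, hg, hs, hfg, hg0, hgM⟩ := exists_zeros_factorization hf hf0 hR0 hM
  obtain ⟨k, hk, hk0, hgk⟩ := exists_log_on_ball hg hR0 hg0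
  have hgf : g 0 = f 0 := by rw [hfg 0]; simp
  set A : ℝ := L + ε * (3 * R) ^ 2 with hA
  have hA0 : 0 < A := by positivity
  have hre : ∀ w ∈ Metric.ball (0 : ℂ) R, (k w).re ≤ A := by
    intro w hw
    have hw' : ‖w‖ < R := by simpa using hw
    have h1 := hgM w (by linarith)
    rw [hgk w hw, norm_mul, Complex.norm_exp, hgf, mul_comm, ← le_div_iff₀ hf0',
      mul_div_right_comm] at h1
    have h2 := Real.log_le_log (Real.exp_pos _) h1
    rw [Real.log_exp, Real.log_mul (by positivity) (Real.exp_pos _).ne', Real.log_exp] at h2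
    have h3 := le_abs_self (Real.log (C / ‖f 0‖))
    linarith
  refine ⟨s, fun ρ hρ => ⟨(hs ρ hρ).1, (hs ρ hρ).2.1⟩, fun ρ hρ hρB => ?_, fun w hw => ?_⟩
  · rw [hfg ρ, mul_eq_zero, or_iff_left (hg0 ρ (by linarith [hR.1])), Multiset.prod_eq_zero_iff,
      Multiset.mem_map] at hρ
    obtain ⟨a, ha, ha'⟩ := hρ
    have ha0 := (hs a ha).2.1
    have : a = ρ := by
      rw [sub_eq_zero, eq_div_iff ha0, one_mul] at ha'; exact ha'
    exact this ▸ ha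
  · have hwball : w ∈ Metric.ball (0 : ℂ) (R / 2) := by simp; linarith [hR.1]
    have hsub : Metric.ball (0 : ℂ) (R / 2) ⊆ Metric.ball 0 R :=
      Metric.ball_subset_ball (by linarith)
    have hneg : ∀ z ∈ Metric.ball (0 : ℂ) (R / 2), -z ∈ Metric.ball (0 : ℂ) (R / 2) := by
      intro z hz; simpa using hz
    refine ⟨k w + k (-w), ?_, ?_⟩
    -- Borel–Carathéodory bounds `k` only by a multiple of `R ^ 2`. Symmetrising removes the linear
    -- term, and the second-order zero at the origin supplies the compensating `(B / R) ^ 2`.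
    · have h := norm_even_le (m := fun z => k z + k (-z)) (r := R / 2) (A := 4 * A) (by positivity)
        (DifferentiableOn.add (hk.mono hsub)
          ((hk.mono hsub).comp differentiable_neg.differentiableOn hneg))
        (by simp [hk0]) (fun z => by simp [add_comm])
        (fun z hz => (norm_add_le _ _).trans (by
          have h1 := borelCaratheodory_half hR0 hA0 hk hk0 hre hz
          have h2 := borelCaratheodory_half hR0 hA0 hk hk0 hre (hneg z hz)
          linarith)) hwball
      refine h.trans ?_
      have h1 : (‖w‖ / (R / 2)) ^ 2 ≤ (B / (R / 2)) ^ 2 := by gcongr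
      calc 4 * A * (‖w‖ / (R / 2)) ^ 2 ≤ 4 * A * (B / (R / 2)) ^ 2 := by gcongr
        _ = 16 * B ^ 2 * L / R ^ 2 + 144 * B ^ 2 * ε := by rw [hA]; field_simp; ring
        _ ≤ δ / 2 + δ / 2 := by
          refine add_le_add ?_ ?_
          · rw [div_le_iff₀ (by positivity)]; linarith [hR.2]
          · rw [hεdef]; apply le_of_eq; field_simp; norm_num
        _ = δ := by ring
    · rw [hfg w, hfg (-w), hgk w (hsub hwball), hgk (-w) (hsub (hneg w hwball)), hgf,
        Complex.exp_add, Multiset.prod_map_mul]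
      have : (s.map fun ρ => 1 - -w / ρ) = s.map fun ρ => 1 + w / ρ := by
        congr 1; ext ρ; ring
      rw [this]
      ring

/-! ### Comparison of moduli through the zeros -/

/-- The product of the distances of `w` to the orbit of `ρ` under the Klein four-group generated
by negation and complex conjugation, up to the factor `‖ρ‖ ^ 4`. -/
noncomputable def orbitFactor (w ρ : ℂ) : ℝ :=
  ‖(1 - w / ρ) * (1 + w / ρ)‖ *
    ‖(1 - starRingEnd ℂ w / ρ) * (1 + starRingEnd ℂ w / ρ)‖

lemma orbitFactor_nonneg (w ρ : ℂ) : 0 ≤ orbitFactor w ρ := by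
  unfold orbitFactor; positivity

/-- Splits the factor into the conjugate-pair distances for `ρ` and for `-ρ`, the quantities
compared in `add_ne_zero`. -/
lemma orbitFactor_eq (w : ℂ) {ρ : ℂ} (hρ : ρ ≠ 0) :
    orbitFactor w ρ = ‖(w - ρ) * (w - starRingEnd ℂ ρ)‖ *
      ‖(w - -ρ) * (w - starRingEnd ℂ (-ρ))‖ / ‖ρ‖ ^ 4 := by
  have h1 : 1 - w / ρ = -(w - ρ) / ρ := by field_simp; ring
  have h2 : 1 + w / ρ = (w - -ρ) / ρ := by field_simp; ring
  have h3 : 1 - starRingEnd ℂ w / ρ = -(starRingEnd ℂ (w - starRingEnd ℂ ρ)) / ρ := by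
    simp only [map_sub, Complex.conj_conj]; field_simp; ring
  have h4 : 1 + starRingEnd ℂ w / ρ = starRingEnd ℂ (w - starRingEnd ℂ (-ρ)) / ρ := by
    simp only [map_sub, map_neg, Complex.conj_conj]; field_simp; ring
  have := norm_pos_iff.2 hρ
  rw [orbitFactor, h1, h2, h3, h4]
  simp only [norm_mul, norm_div, norm_neg, RCLike.norm_conj]
  field_simp

lemma norm_multiset_prod {ι : Type*} (s : Multiset ι) (F : ι → ℂ) :
    ‖(s.map F).prod‖ = (s.map fun i => ‖F i‖).prod := by
  induction s using Multiset.induction_on with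
  | empty => simp
  | cons a s ih => simp [ih]

lemma multiset_prod_map_nonneg {ι : Type*} (s : Multiset ι) {F : ι → ℝ} (hF : ∀ i, 0 ≤ F i) :
    0 ≤ (s.map F).prod :=
  Multiset.prod_nonneg fun a ha => by
    obtain ⟨i, -, rfl⟩ := Multiset.mem_map.1 ha; exact hF i

lemma multiset_prod_map_mono {ι : Type*} (s : Multiset ι) {F G : ι → ℝ} (hF : ∀ i, 0 ≤ F i)
    (h : ∀ i ∈ s, F i ≤ G i) : (s.map F).prod ≤ (s.map G).prod := by
  induction s using Multiset.induction_on with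
  | empty => simp
  | cons a s ih =>
    simp only [Multiset.map_cons, Multiset.prod_cons]
    exact mul_le_mul (h a (Multiset.mem_cons_self a s))
      (ih fun i hi => h i (Multiset.mem_cons_of_mem hi)) (multiset_prod_map_nonneg s hF)
      ((hF a).trans (h a (Multiset.mem_cons_self a s)))

/-- Even entire functions, real on the real axis, not vanishing at the origin, and of growth
`exp (o (‖z‖ ^ 2))`. -/
structure IsEvenRealEntire (f : ℂ → ℂ) : Prop where
  differentiable : Differentiable ℂ f
  map_zero_ne : f 0 ≠ 0
  growth : ∀ ε : ℝ, 0 < ε → ∃ C : ℝ, ∀ z, ‖f z‖ ≤ C * Real.exp (ε * ‖z‖ ^ 2)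
  map_neg : ∀ z, f (-z) = f z
  map_conj : ∀ z, f (starRingEnd ℂ z) = starRingEnd ℂ (f z)

lemma RapidKernel.isEvenRealEntire {K : ℝ → ℝ} (hK : RapidKernel K) :
    IsEvenRealEntire (cosTransform K) :=
  ⟨hK.differentiable_cosTransform, hK.cosTransform_zero_ne, fun _ => hK.norm_cosTransform_le,
    cosTransform_neg K, cosTransform_conj K⟩

namespace IsEvenRealEntire

variable {f : ℂ → ℂ}

/-- Evenness makes `f w * f (-w)` a square. Multiplying the factorizations at `w` and at its
conjugate, where `f` has the same modulus, gives the fourth power and groups each zero with its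
conjugate. -/
lemma exists_approx_norm_pow_four (h : IsEvenRealEntire f) (B : ℝ) {δ : ℝ} (hδ : 0 < δ) :
    ∃ s : Multiset ℂ, (∀ ρ ∈ s, f ρ = 0 ∧ ρ ≠ 0) ∧ (∀ ρ, f ρ = 0 → ‖ρ‖ ≤ B → ρ ∈ s) ∧
      ∀ w, ‖w‖ ≤ B → ∃ r : ℝ, |r| ≤ δ ∧
        ‖f w‖ ^ 4 = ‖f 0‖ ^ 4 * (s.map (orbitFactor w)).prod * Real.exp r := by
  obtain ⟨s, hs, hs', happ⟩ := exists_approx_factorization h.differentiable h.map_zero_ne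
    h.growth B (half_pos hδ)
  refine ⟨s, hs, hs', fun w hw => ?_⟩
  obtain ⟨m, hm, hw1⟩ := happ w hw
  obtain ⟨n, hn, hw2⟩ := happ (starRingEnd ℂ w) (by rwa [RCLike.norm_conj])
  refine ⟨m.re + n.re, ?_, ?_⟩
  · have h1 := (Complex.abs_re_le_norm m).trans hm
    have h2 := (Complex.abs_re_le_norm n).trans hn
    linarith [abs_add_le m.re n.re]
  · rw [h.map_neg] at hw1 hw2
    have e1 := congrArg norm hw1
    have e2 := congrArg norm hw2
    rw [h.map_conj] at e2
    rw [norm_mul, norm_mul, norm_mul, norm_pow, Complex.norm_exp, norm_multiset_prod] at e1 e2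
    rw [RCLike.norm_conj] at e2
    have hP : (s.map (orbitFactor w)).prod =
        (s.map fun ρ => ‖(1 - w / ρ) * (1 + w / ρ)‖).prod *
        (s.map fun ρ => ‖(1 - starRingEnd ℂ w / ρ) * (1 + starRingEnd ℂ w / ρ)‖).prod := by
      rw [← Multiset.prod_map_mul]; rfl
    have e : ‖f w‖ ^ 4 = (‖f w‖ * ‖f w‖) * (‖f w‖ * ‖f w‖) := by ring
    rw [e, hP, Real.exp_add]
    nth_rewrite 1 [e1]
    rw [e2]
    ring

/-- A zero-free such function is constant. -/
lemma eq_of_forall_ne_zero (h : IsEvenRealEntire f) (hne : ∀ z, f z ≠ 0) (z w : ℂ) :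
    f z = f w := by
  refine h.differentiable.apply_eq_apply_of_bounded ?_ z w
  refine isBounded_iff_forall_norm_le.2 ⟨‖f 0‖ * Real.exp 1, ?_⟩
  rintro _ ⟨w, rfl⟩
  obtain ⟨s, hs, -, happ⟩ := h.exists_approx_norm_pow_four ‖w‖ (δ := 1) one_pos
  have hs0 : s = 0 := Multiset.eq_zero_of_forall_notMem fun ρ hρ => hne ρ (hs ρ hρ).1
  obtain ⟨r, hr, hw⟩ := happ w le_rfl
  rw [hs0, Multiset.map_zero, Multiset.prod_zero, mul_one] at hw
  refine le_of_pow_le_pow_left₀ (n := 4) (by norm_num) (by positivity) ?_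
  rw [hw, mul_pow, ← Real.exp_nat_mul]
  gcongr
  have := (abs_le.1 hr).2
  push_cast
  linarith

/-- If every zero of `f`, together with its conjugate, is nearer to `w₂` than to `w₁`, then
`f w₁` and `f w₂` do not cancel. -/
theorem add_ne_zero (h : IsEvenRealEntire f) (hnc : ∃ z, f z ≠ f 0) {w₁ w₂ : ℂ}
    (hz : ∀ ρ, f ρ = 0 →
      ‖(w₂ - ρ) * (w₂ - starRingEnd ℂ ρ)‖ < ‖(w₁ - ρ) * (w₁ - starRingEnd ℂ ρ)‖) :
    f w₁ + f w₂ ≠ 0 := by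
  have hw₁ : f w₁ ≠ 0 := fun h0 => by
    have := hz w₁ h0
    simp only [sub_self, zero_mul, norm_zero] at this
    exact absurd this (not_lt.2 (norm_nonneg _))
  intro hsum
  obtain ⟨ρ₀, hρ₀⟩ : ∃ ρ, f ρ = 0 := by
    by_contra! hne
    obtain ⟨z, hz⟩ := hnc
    exact hz (h.eq_of_forall_ne_zero hne z 0)
  have hfac : ∀ ρ, f ρ = 0 → orbitFactor w₂ ρ < orbitFactor w₁ ρ := by
    intro ρ hρ
    have hρ0 : ρ ≠ 0 := fun e => h.map_zero_ne (e ▸ hρ)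
    have h1 := hz ρ hρ
    have h2 := hz (-ρ) (by rw [h.map_neg, hρ])
    rw [orbitFactor_eq _ hρ0, orbitFactor_eq _ hρ0]
    have := norm_pos_iff.2 hρ0
    refine (div_lt_div_iff_of_pos_right (by positivity)).2 ?_
    exact mul_lt_mul'' h1 h2 (norm_nonneg _) (norm_nonneg _)
  -- The approximate products lose up to `exp (2 * δ)` in total. One fixed zero `ρ₀` gives a strict
  -- gain independent of `δ`, so `δ` is chosen below that gain; the other zeros contribute in the
  -- right direction.
  have hlim : Tendsto (fun δ : ℝ => orbitFactor w₂ ρ₀ * Real.exp (2 * δ)) (𝓝[>] 0)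
      (𝓝 (orbitFactor w₂ ρ₀)) := by
    have : Continuous fun δ : ℝ => orbitFactor w₂ ρ₀ * Real.exp (2 * δ) := by fun_prop
    have := (this.tendsto 0).mono_left (nhdsWithin_le_nhds (s := Ioi 0))
    simpa using this
  obtain ⟨δ, hδ, hδ0⟩ :=
    ((hlim.eventually_lt_const (hfac ρ₀ hρ₀)).and self_mem_nhdsWithin).exists
  have hδ0 : 0 < δ := hδ0
  obtain ⟨s, hs, hs', happ⟩ :=
    h.exists_approx_norm_pow_four (max ‖ρ₀‖ (max ‖w₁‖ ‖w₂‖)) hδ0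
  obtain ⟨t, rfl⟩ := Multiset.exists_cons_of_mem (hs' ρ₀ hρ₀ (le_max_left _ _))
  obtain ⟨r₁, hr₁, e₁⟩ := happ w₁ ((le_max_left _ _).trans (le_max_right _ _))
  obtain ⟨r₂, hr₂, e₂⟩ := happ w₂ ((le_max_right _ _).trans (le_max_right _ _))
  have hnorm : ‖f w₂‖ = ‖f w₁‖ := by rw [← norm_neg, eq_neg_of_add_eq_zero_left hsum]
  rw [hnorm, e₁, Multiset.map_cons, Multiset.map_cons, Multiset.prod_cons,
    Multiset.prod_cons] at e₂
  rw [Multiset.map_cons, Multiset.prod_cons] at e₁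
  have hP : (t.map (orbitFactor w₂)).prod ≤ (t.map (orbitFactor w₁)).prod :=
    multiset_prod_map_mono t (orbitFactor_nonneg w₂) fun ρ hρ =>
      (hfac ρ (hs ρ (Multiset.mem_cons_of_mem hρ)).1).le
  have hP0 : 0 < (t.map (orbitFactor w₁)).prod := by
    refine (multiset_prod_map_nonneg t (orbitFactor_nonneg w₁)).lt_of_ne' fun h0 => ?_
    rw [h0] at e₁
    simp [hw₁] at e₁
  have ha : 0 < ‖f 0‖ ^ 4 := by have := norm_pos_iff.2 h.map_zero_ne; positivity
  rw [mul_assoc, mul_assoc (‖f 0‖ ^ 4), mul_right_inj' ha.ne'] at e₂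
  have hq₂ := orbitFactor_nonneg w₂ ρ₀
  have hq₁ := orbitFactor_nonneg w₁ ρ₀
  have hub : orbitFactor w₂ ρ₀ * (t.map (orbitFactor w₂)).prod * Real.exp r₂ ≤
      orbitFactor w₂ ρ₀ * (t.map (orbitFactor w₁)).prod * Real.exp δ := by
    gcongr; exact (abs_le.1 hr₂).2
  have hlb : orbitFactor w₁ ρ₀ * (t.map (orbitFactor w₁)).prod * Real.exp (-δ) ≤
      orbitFactor w₁ ρ₀ * (t.map (orbitFactor w₁)).prod * Real.exp r₁ := by
    gcongr; exact (abs_le.1 hr₁).1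
  have hfin := (hlb.trans_eq e₂).trans hub
  have e3 : orbitFactor w₂ ρ₀ * (t.map (orbitFactor w₁)).prod * Real.exp δ =
      (orbitFactor w₂ ρ₀ * Real.exp (2 * δ)) * ((t.map (orbitFactor w₁)).prod * Real.exp (-δ)) := by
    rw [show Real.exp δ = Real.exp (2 * δ) * Real.exp (-δ) by rw [← Real.exp_add]; congr 1; ring]
    ring
  rw [e3, mul_assoc] at hfin
  exact absurd (le_of_mul_le_mul_right hfin (by positivity)) (not_le.2 hδ)

end IsEvenRealEntire

/-! ### Vertical averaging and the motion of zeros -/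

lemma norm_mul_sub_conj_sq (x v a b : ℝ) :
    ‖((x : ℂ) + v * Complex.I - (a + b * Complex.I)) *
      ((x : ℂ) + v * Complex.I - starRingEnd ℂ (a + b * Complex.I))‖ ^ 2 =
    ((x - a) ^ 2 + (v - b) ^ 2) * ((x - a) ^ 2 + (v + b) ^ 2) := by
  rw [norm_mul, mul_pow, ← Complex.normSq_eq_norm_sq, ← Complex.normSq_eq_norm_sq,
    Complex.normSq_apply, Complex.normSq_apply]
  simp
  ring

/-- Averaging over a vertical shift cannot create zeros above the points that dominate every
zero. -/
lemma cosTransform_cosh_ne_zero {K : ℝ → ℝ} (hK : RapidKernel K) {l x y : ℝ} (hl : 0 < l)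
    (hy : 0 < y) (hz : ∀ a b : ℝ, cosTransform K (a + b * Complex.I) = 0 →
      b ^ 2 < (x - a) ^ 2 + y ^ 2 + l ^ 2) :
    cosTransform (fun u => K u * Real.cosh (l * u)) (x + y * Complex.I) ≠ 0 := by
  rw [cosTransform_mul_cosh hK]
  refine div_ne_zero (hK.isEvenRealEntire.add_ne_zero ⟨_, hK.cosTransform_I_ne⟩ fun ρ hρ => ?_)
    two_ne_zero
  rw [← Complex.re_add_im ρ] at hρ ⊢
  have h := hz _ _ hρ
  have e1 : (x : ℂ) + y * Complex.I + l * Complex.I = x + ((y + l : ℝ) : ℂ) * Complex.I := by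
    push_cast; ring
  have e2 : (x : ℂ) + y * Complex.I - l * Complex.I = x + ((y - l : ℝ) : ℂ) * Complex.I := by
    push_cast; ring
  refine lt_of_pow_lt_pow_left₀ 2 (norm_nonneg _) ?_
  rw [e1, e2, norm_mul_sub_conj_sq, norm_mul_sub_conj_sq]
  -- This is exactly the difference of the squared pair distances at heights `y + l` and `y - l`.
  have : 0 < 8 * y * l * ((x - ρ.re) ^ 2 + y ^ 2 + l ^ 2 - ρ.im ^ 2) :=
    mul_pos (by positivity) (by linarith)
  linarith

lemma cosTransform_conj_eq_zero {K : ℝ → ℝ} {a b : ℝ}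
    (h : cosTransform K (a + b * Complex.I) = 0) :
    cosTransform K (a + (-b : ℝ) * Complex.I) = 0 := by
  have h1 := cosTransform_conj K (a + b * Complex.I)
  rw [h, map_zero] at h1
  rw [← h1]; congr 1; simp

lemma cosTransform_reflect_eq_zero {K : ℝ → ℝ} {a b : ℝ}
    (h : cosTransform K (a + b * Complex.I) = 0) :
    cosTransform K ((-a : ℝ) + b * Complex.I) = 0 := by
  have h1 := cosTransform_conj_eq_zero h
  rw [← cosTransform_neg] at h1
  rw [← h1]; congr 1; push_cast; ring

lemma cosTransform_abs_eq_zero {K : ℝ → ℝ} {a b : ℝ}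
    (h : cosTransform K (a + b * Complex.I) = 0) :
    cosTransform K (|a| + (|b| : ℝ) * Complex.I) = 0 := by
  have h1 : cosTransform K (a + (|b| : ℝ) * Complex.I) = 0 := by
    rcases abs_choice b with e | e <;> rw [e]
    exacts [h, cosTransform_conj_eq_zero h]
  rcases abs_choice a with e | e <;> rw [e]
  exacts [h1, cosTransform_reflect_eq_zero h1]

/-- Discrete form of de Bruijn's theorem. -/
lemma sq_im_le_of_cosh_pow {K : ℝ → ℝ} (hK : RapidKernel K) {l D : ℝ} (hl : 0 < l)
    (hD : ∀ a b : ℝ, cosTransform K (a + b * Complex.I) = 0 → b ^ 2 ≤ max D 0) (k : ℕ) :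
    ∀ a b : ℝ, cosTransform (fun u => K u * Real.cosh (l * u) ^ k) (a + b * Complex.I) = 0 →
      b ^ 2 ≤ max (D - k * l ^ 2) 0 := by
  induction k with
  | zero => simpa using hD
  | succ k ih =>
    intro a b hab
    by_contra! hlt
    have hb : 0 < |b| := abs_pos.2 fun h => by simp [h] at hlt
    rw [← sq_abs b] at hlt
    -- The averaging criterion needs positive height, so the zero is reflected into the first
    -- quadrant.
    have h0 := cosTransform_abs_eq_zero hab
    have hker : (fun u => K u * Real.cosh (l * u) ^ (k + 1)) =
        fun u => (K u * Real.cosh (l * u) ^ k) * Real.cosh (l * u) := by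
      ext u; rw [pow_succ, mul_assoc]
    rw [hker] at h0
    refine cosTransform_cosh_ne_zero (hK.mul_cosh_pow l k) hl hb (fun a' b' h' => ?_) h0
    refine (ih a' b' h').trans_lt (max_lt ?_ ?_)
    · have h1 := (le_max_left _ _).trans_lt hlt
      push_cast at h1
      nlinarith [sq_nonneg (|a| - a')]
    · positivity

/-! ### From the discrete to the continuous heat flow -/

lemma one_add_sq_div_two_le_cosh (x : ℝ) : 1 + x ^ 2 / 2 ≤ Real.cosh x := by
  have h := sum_le_hasSum (Finset.range 2) (fun n _ => by positivity) (Real.hasSum_cosh |x|)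
  norm_num [Finset.sum_range_succ] at h
  exact h

/-- With `x = (l * u) ^ 2 / 2`, one has `(1 - x ^ 2) * exp x ≤ 1 + x ≤ cosh (l * u) ≤ exp x`. Taking
`k`-th powers, Bernoulli's inequality turns `(1 - x ^ 2) ^ k` into `1 - k * x ^ 2`. -/
lemma exp_sub_cosh_pow (l u : ℝ) (k : ℕ) :
    |Real.cosh (l * u) ^ k - Real.exp (k * l ^ 2 / 2 * u ^ 2)| ≤
      k * l ^ 4 / 4 * (u ^ 4 * Real.exp (k * l ^ 2 / 2 * u ^ 2)) := by
  set x : ℝ := (l * u) ^ 2 / 2 with hx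
  have hx0 : 0 ≤ x := by positivity
  have hexp : Real.exp (k * l ^ 2 / 2 * u ^ 2) = Real.exp x ^ k := by
    rw [← Real.exp_nat_mul]; congr 1; rw [hx]; ring
  have hup : Real.cosh (l * u) ^ k ≤ Real.exp x ^ k :=
    pow_le_pow_left₀ (Real.cosh_pos _).le (Real.cosh_le_exp_half_sq _) _
  have hc : 1 + x ≤ Real.cosh (l * u) := one_add_sq_div_two_le_cosh _
  have hlow : (1 - k * x ^ 2) * Real.exp x ^ k ≤ Real.cosh (l * u) ^ k := by
    rcases le_or_gt (1 - k * x ^ 2) 0 with h | h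
    · exact (mul_nonpos_of_nonpos_of_nonneg h (by positivity)).trans
        (pow_nonneg (Real.cosh_pos _).le _)
    · rcases Nat.eq_zero_or_pos k with rfl | hk
      · simp
      have hk1 : (1 : ℝ) ≤ k := by exact_mod_cast hk
      have hx1 : x ^ 2 ≤ 1 := by nlinarith [sq_nonneg x]
      have hb := one_add_mul_le_pow (a := -x ^ 2) (by linarith) k
      calc (1 - k * x ^ 2) * Real.exp x ^ k ≤ (1 + -x ^ 2) ^ k * Real.exp x ^ k := by
            gcongr; linarith
        _ = ((1 - x ^ 2) * Real.exp x) ^ k := by rw [mul_pow]; ring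
        _ ≤ Real.cosh (l * u) ^ k := by
            refine pow_le_pow_left₀ (mul_nonneg (by linarith) (Real.exp_pos _).le) ?_ _
            refine le_trans ?_ hc
            have h1 : (1 - x) * Real.exp x ≤ 1 := by
              have := Real.one_sub_le_exp_neg x
              calc (1 - x) * Real.exp x ≤ Real.exp (-x) * Real.exp x := by gcongr
                _ = 1 := by rw [← Real.exp_add]; simp
            calc (1 - x ^ 2) * Real.exp x = (1 + x) * ((1 - x) * Real.exp x) := by ring
              _ ≤ (1 + x) * 1 := by gcongr
              _ = 1 + x := mul_one _
  rw [hexp, abs_le]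
  have hxe : (k : ℝ) * x ^ 2 = k * l ^ 4 / 4 * u ^ 4 := by rw [hx]; ring
  have hpos : 0 ≤ k * x ^ 2 * Real.exp x ^ k := by positivity
  rw [← mul_assoc, ← hxe]
  constructor <;> linarith

/-- The constant depends only on the elapsed time and the strip: the pointwise error carries `k * l
^ 4`, which is at most `2 * T * l ^ 2`. -/
lemma norm_cosTransform_sub_le {K : ℝ → ℝ} (hK : RapidKernel K) (T B : ℝ) :
    ∃ M : ℝ, ∀ (l : ℝ) (k : ℕ), k * l ^ 2 / 2 ≤ T → ∀ z : ℂ, |z.im| ≤ B →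
      ‖cosTransform (fun u => K u * Real.cosh (l * u) ^ k) z -
        cosTransform (fun u => K u * Real.exp (k * l ^ 2 / 2 * u ^ 2)) z‖ ≤ M * l ^ 2 := by
  have hint : IntegrableOn
      (fun u => (K u * Real.exp (T * u ^ 2)) * (u ^ 4 * Real.exp (B * u))) (Ioi 0) := by
    refine (hK.mul_exp T).integrableOn_smul (g := fun u => u ^ 4 * Real.exp (B * u))
      (C := 24 * Real.exp ((1 + B) ^ 2)) (c := 1) (by fun_prop) fun u hu => ?_
    rw [Real.norm_of_nonneg (by positivity), mul_assoc]
    have h1 : u ^ 4 ≤ 24 * Real.exp u := by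
      have := Real.pow_div_factorial_le_exp u hu.le 4
      norm_num [Nat.factorial] at this
      linarith
    calc u ^ 4 * Real.exp (B * u) ≤ 24 * Real.exp u * Real.exp (B * u) := by gcongr
      _ = 24 * Real.exp ((1 + B) * u) := by rw [mul_assoc, ← Real.exp_add]; ring_nf
      _ ≤ _ := by gcongr; exact exp_mul_le _ _
  refine ⟨T / 2 * ∫ u in Ioi (0 : ℝ), (K u * Real.exp (T * u ^ 2)) * (u ^ 4 * Real.exp (B * u)),
    fun l k hkT z hz => ?_⟩
  rw [cosTransform, cosTransform, ← integral_sub ((hK.mul_cosh_pow l k).integrableOn_cos z)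
    ((hK.mul_exp _).integrableOn_cos z), mul_right_comm, ← integral_const_mul]
  refine norm_integral_le_of_norm_le (hint.const_mul _) ?_
  filter_upwards [ae_restrict_mem measurableSet_Ioi] with u hu
  have hu : 0 < u := hu
  have hT : 0 ≤ T := le_trans (by positivity) hkT
  have hKu := (hK.pos u hu).le
  rw [← sub_mul, ← Complex.ofReal_sub, ← mul_sub, norm_mul, Complex.norm_real, norm_mul,
    Real.norm_of_nonneg hKu, Real.norm_eq_abs]
  have h1 := exp_sub_cosh_pow l u k
  have h2 : ‖Complex.cos (z * u)‖ ≤ Real.exp (B * u) :=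
    (norm_cos_mul_le z hu).trans (Real.exp_le_exp.2 (by gcongr))
  have h3 : (k : ℝ) * l ^ 4 / 4 ≤ T / 2 * l ^ 2 := by nlinarith [sq_nonneg l]
  calc K u * |Real.cosh (l * u) ^ k - Real.exp (k * l ^ 2 / 2 * u ^ 2)| * ‖Complex.cos (z * u)‖
      ≤ K u * (T / 2 * l ^ 2 * (u ^ 4 * Real.exp (T * u ^ 2))) * Real.exp (B * u) := by
        gcongr
        refine h1.trans ?_
        gcongr
    _ = _ := by ring

/-- The step of the discrete heat flow that reaches time `T` in `n + 1` steps. -/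
noncomputable def stepSize (T : ℝ) (n : ℕ) : ℝ := Real.sqrt (2 * T / (n + 1))

lemma stepSize_sq {T : ℝ} (hT : 0 ≤ T) (n : ℕ) : stepSize T n ^ 2 = 2 * T / (n + 1) :=
  Real.sq_sqrt (by positivity)

lemma stepSize_pos {T : ℝ} (hT : 0 < T) (n : ℕ) : 0 < stepSize T n :=
  Real.sqrt_pos.2 (by positivity)

/-- The discrete heat flow converges uniformly on strips to the continuous one. -/
lemma eventually_norm_cosTransform_sub_le {K : ℝ → ℝ} (hK : RapidKernel K) {T : ℝ} (hT : 0 < T)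
    (B : ℝ) {ε : ℝ} (hε : 0 < ε) :
    ∀ᶠ n : ℕ in atTop, ∀ k ≤ n + 1, ∀ z : ℂ, |z.im| ≤ B →
      ‖cosTransform (fun u => K u * Real.cosh (stepSize T n * u) ^ k) z -
        cosTransform (fun u => K u * Real.exp (k * (T / (n + 1)) * u ^ 2)) z‖ ≤ ε := by
  obtain ⟨M, hM⟩ := norm_cosTransform_sub_le hK T B
  have hlim : Tendsto (fun n : ℕ => M * (2 * T / ((n : ℝ) + 1))) atTop (𝓝 0) := by
    have := (tendsto_one_div_add_atTop_nhds_zero_nat (𝕜 := ℝ)).const_mul (M * (2 * T))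
    simp only [mul_zero] at this
    refine this.congr fun n => by ring
  filter_upwards [hlim.eventually_le_const hε] with n hn k hk z hz
  have hk' : (k : ℝ) ≤ n + 1 := by exact_mod_cast hk
  have e : (k : ℝ) * stepSize T n ^ 2 / 2 = k * (T / (n + 1)) := by
    rw [stepSize_sq hT.le]; ring
  have h := hM (stepSize T n) k (by
    rw [e, mul_div_assoc', div_le_iff₀ (by positivity)]; nlinarith) z hz
  rw [e, stepSize_sq hT.le] at h
  exact h.trans hn

/-- Hurwitz: a zero of a limit of entire functions is a limit of zeros. -/
lemma hurwitz {F : ℂ → ℂ} {G : ℕ → ℂ → ℂ} (hF : Differentiable ℂ F)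
    (hG : ∀ n, Differentiable ℂ (G n)) (hF0 : F 0 ≠ 0)
    (hlim : ∀ B ε : ℝ, 0 < ε → ∀ᶠ n in atTop, ∀ z : ℂ, |z.im| ≤ B → ‖G n z - F z‖ ≤ ε)
    {U : Set ℂ} (hU : IsOpen U) (hne : ∀ᶠ n in atTop, ∀ z ∈ U, G n z ≠ 0) {z₀ : ℂ} (hz₀ : z₀ ∈ U) :
    F z₀ ≠ 0 := by
  intro hFz
  have hev : ∀ᶠ z in 𝓝[≠] z₀, F z ≠ 0 := by
    refine ((hF.analyticAt z₀).eventually_eq_zero_or_eventually_ne_zero).resolve_left fun h => ?_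
    have han : AnalyticOnNhd ℂ F univ := fun z _ => hF.analyticAt z
    exact hF0 (han.eqOn_zero_of_preconnected_of_eventuallyEq_zero isPreconnected_univ
      (mem_univ z₀) h (mem_univ 0))
  rw [eventually_nhdsWithin_iff] at hev
  obtain ⟨r, hr, hball⟩ := Metric.nhds_basis_closedBall.mem_iff.1 (hev.and (hU.mem_nhds hz₀))
  have hsphere : ∀ z ∈ Metric.sphere z₀ r, F z ≠ 0 := fun z hz =>
    (hball (Metric.sphere_subset_closedBall hz)).1 fun h => by
      rw [mem_singleton_iff] at h
      simp [h] at hz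
      exact hr.ne hz
  obtain ⟨w, hw, hmin⟩ := (isCompact_sphere z₀ r).exists_isMinOn
    (NormedSpace.sphere_nonempty.2 hr.le) (hF.continuous.norm.continuousOn)
  have hε : 0 < ‖F w‖ := norm_pos_iff.2 (hsphere w hw)
  obtain ⟨n, hn, hGne⟩ :=
    ((hlim (|z₀.im| + r) (‖F w‖ / 3) (by positivity)).and hne).exists
  have him : ∀ z ∈ Metric.closedBall z₀ r, |z.im| ≤ |z₀.im| + r := by
    intro z hz
    have h1 : |(z - z₀).im| ≤ r := (Complex.abs_im_le_norm _).trans (by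
      simpa [dist_eq_norm] using hz)
    have h2 := abs_add_le z₀.im (z - z₀).im
    simp only [Complex.sub_im, add_sub_cancel] at h1 h2
    linarith
  have hcl : closure (Metric.ball z₀ r) = Metric.closedBall z₀ r := closure_ball _ hr.ne'
  -- Maximum principle for `1 / G n`: on the sphere `‖G n‖` is at least two thirds of the minimum of
  -- `‖F‖`, while at the centre it is at most one third.
  have hdiff : DiffContOnCl ℂ (fun z => (G n z)⁻¹) (Metric.ball z₀ r) := by
    refine DiffContOnCl.inv (hG n).diffContOnCl fun z hz => hGne z ?_
    rw [hcl] at hz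
    exact (hball hz).2
  have hbd := Complex.norm_le_of_forall_mem_frontier_norm_le Metric.isBounded_ball hdiff
    (C := (2 * ‖F w‖ / 3)⁻¹) (fun z hz => by
      rw [frontier_ball _ hr.ne'] at hz
      have h1 := hn z (him z (Metric.sphere_subset_closedBall hz))
      have h2 : ‖F w‖ ≤ ‖F z‖ := hmin hz
      have h3 := norm_sub_norm_le (F z) (G n z)
      rw [norm_sub_rev] at h3
      rw [norm_inv]
      exact inv_anti₀ (by positivity) (by linarith))
    (subset_closure (Metric.mem_ball_self hr) : z₀ ∈ closure (Metric.ball z₀ r))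
  have hGz : 0 < ‖G n z₀‖ := norm_pos_iff.2 (hGne z₀ hz₀)
  rw [norm_inv, inv_le_inv₀ hGz (by positivity)] at hbd
  have h1 := hn z₀ (him z₀ (Metric.mem_closedBall_self hr.le))
  rw [hFz, sub_zero] at h1
  linarith

/-- A zero of the heat flow at time `T` is a limit of zeros of the discrete heat flow. -/
lemma cosTransform_exp_ne_zero {K : ℝ → ℝ} (hK : RapidKernel K) {T : ℝ} (hT : 0 < T) {U : Set ℂ}
    (hU : IsOpen U) (hne : ∀ᶠ n : ℕ in atTop, ∀ z ∈ U,
      cosTransform (fun u => K u * Real.cosh (stepSize T n * u) ^ (n + 1)) z ≠ 0)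
    {z₀ : ℂ} (hz₀ : z₀ ∈ U) :
    cosTransform (fun u => K u * Real.exp (T * u ^ 2)) z₀ ≠ 0 := by
  refine hurwitz (hK.mul_exp T).differentiable_cosTransform
    (fun n => (hK.mul_cosh_pow (stepSize T n) (n + 1)).differentiable_cosTransform)
    (hK.mul_exp T).cosTransform_zero_ne (fun B ε hε => ?_) hU hne hz₀
  filter_upwards [eventually_norm_cosTransform_sub_le hK hT B hε] with n hn z hz
  have h := hn (n + 1) le_rfl z hz
  have e : ((n + 1 : ℕ) : ℝ) * (T / (n + 1)) = T := by push_cast; field_simp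
  rwa [e] at h

/-- De Bruijn's theorem: the heat flow narrows a strip that contains all the zeros. -/
theorem sq_im_le_of_exp {K : ℝ → ℝ} (hK : RapidKernel K) {D t : ℝ} (ht : 0 ≤ t)
    (hD : ∀ a b : ℝ, cosTransform K (a + b * Complex.I) = 0 → b ^ 2 ≤ max D 0) {a b : ℝ}
    (hab : cosTransform (fun u => K u * Real.exp (t * u ^ 2)) (a + b * Complex.I) = 0) :
    b ^ 2 ≤ max (D - 2 * t) 0 := by
  rcases ht.eq_or_lt with rfl | ht
  · simp only [zero_mul, Real.exp_zero, mul_one] at hab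
    simpa using hD a b hab
  by_contra! hlt
  refine cosTransform_exp_ne_zero hK ht (U := {z : ℂ | max (D - 2 * t) 0 < z.im ^ 2})
    (isOpen_lt (by fun_prop) (by fun_prop)) (Eventually.of_forall fun n z hz h0 => ?_)
    (z₀ := a + b * Complex.I) (by simpa using hlt) hab
  rw [← Complex.re_add_im z] at h0
  have := sq_im_le_of_cosh_pow hK (stepSize_pos ht n) hD (n + 1) _ _ h0
  have e : ((n + 1 : ℕ) : ℝ) * stepSize t n ^ 2 = 2 * t := by
    rw [stepSize_sq ht.le]; push_cast; field_simp
  rw [e] at this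
  exact absurd hz (not_lt.2 this)

/-! ### Theta series, and evenness and decay of `Phi` -/

/-- The frequencies `π (n + 1) ^ 2` of the theta series. -/
noncomputable def thetaFreq (n : ℕ) : ℝ := Real.pi * ((n : ℝ) + 1) ^ 2

/-- Up to the sign `(-1) ^ j`, the `j`-th derivative of `∑ exp (-π n ^ 2 t)`, `n ≥ 1`. -/
noncomputable def thetaSum (j : ℕ) (t : ℝ) : ℝ :=
  ∑' n : ℕ, thetaFreq n ^ j * Real.exp (-thetaFreq n * t)

lemma thetaFreq_pos (n : ℕ) : 0 < thetaFreq n := by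
  unfold thetaFreq; positivity

lemma pi_le_thetaFreq (n : ℕ) : Real.pi ≤ thetaFreq n := by
  have : (1 : ℝ) ≤ ((n : ℝ) + 1) ^ 2 := one_le_pow₀ (by linarith [n.cast_nonneg (α := ℝ)])
  unfold thetaFreq
  nlinarith [Real.pi_pos]

lemma summable_thetaSum (j : ℕ) {t : ℝ} (ht : 0 < t) :
    Summable fun n : ℕ => thetaFreq n ^ j * Real.exp (-thetaFreq n * t) := by
  have h := (Real.summable_pow_mul_exp_neg_nat_mul (2 * j) (r := Real.pi * t)
    (by positivity)).comp_injective (add_left_injective 1)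
  refine Summable.of_nonneg_of_le (fun n => by have := thetaFreq_pos n; positivity) (fun n => ?_)
    (h.mul_left (Real.pi ^ j))
  simp only [Function.comp_apply, Nat.cast_add, Nat.cast_one]
  rw [thetaFreq, mul_pow, ← pow_mul, mul_assoc]
  gcongr _ * (_ * Real.exp ?_)
  have h1 : (n : ℝ) + 1 ≤ ((n : ℝ) + 1) ^ 2 := by nlinarith [n.cast_nonneg (α := ℝ)]
  have h2 : 0 < Real.pi * t := by positivity
  nlinarith

lemma thetaSum_pos (j : ℕ) {t : ℝ} (ht : 0 < t) : 0 < thetaSum j t :=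
  (summable_thetaSum j ht).tsum_pos (fun n => by have := thetaFreq_pos n; positivity) 0
    (by have := thetaFreq_pos 0; positivity)

lemma hasDerivAt_thetaSum (j : ℕ) {t : ℝ} (ht : 0 < t) :
    HasDerivAt (thetaSum j) (-thetaSum (j + 1) t) t := by
  have h := hasDerivAt_tsum_of_isPreconnected
    (g := fun n t => thetaFreq n ^ j * Real.exp (-thetaFreq n * t))
    (g' := fun n t => -(thetaFreq n ^ (j + 1) * Real.exp (-thetaFreq n * t)))
    (t := Ioi (t / 2)) (y₀ := t) (y := t)
    (summable_thetaSum (j + 1) (half_pos ht)) isOpen_Ioi isPreconnected_Ioi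
    (fun n y _ => by
      have := (((hasDerivAt_id y).const_mul (-thetaFreq n)).exp).const_mul (thetaFreq n ^ j)
      refine this.congr_deriv ?_
      simp only [id, mul_one]
      ring)
    (fun n y hy => by
      have := thetaFreq_pos n
      have hy : t / 2 < y := hy
      rw [norm_neg, Real.norm_of_nonneg (by positivity)]
      gcongr _ * Real.exp ?_
      nlinarith)
    (by simp [ht]) (summable_thetaSum j ht) (by simp [ht])
  rw [tsum_neg] at h
  exact h

lemma continuousOn_thetaSum (j : ℕ) : ContinuousOn (thetaSum j) (Ioi 0) := fun _ ht =>
  (hasDerivAt_thetaSum j ht).continuousAt.continuousWithinAt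

lemma tsum_int_exp_eq {t : ℝ} (ht : 0 < t) :
    ∑' n : ℤ, Real.exp (-Real.pi * t * (n : ℝ) ^ 2) = 1 + 2 * thetaSum 0 t := by
  have hs := summable_thetaSum 0 ht
  have e : ∀ n : ℕ, Real.exp (-Real.pi * t * ((n : ℝ) + 1) ^ 2) =
      thetaFreq n ^ 0 * Real.exp (-thetaFreq n * t) := fun n => by
    rw [thetaFreq, pow_zero, one_mul]; congr 1; ring
  have hs1 : Summable fun n : ℕ => Real.exp (-Real.pi * t * ((n : ℝ) + 1) ^ 2) := by
    simpa only [e] using hs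
  have hs0 : Summable fun n : ℕ => Real.exp (-Real.pi * t * (n : ℝ) ^ 2) := by
    rw [← summable_nat_add_iff 1]; simpa using hs1
  rw [tsum_of_nat_of_neg_add_one (by simpa using hs0) (by
    refine hs1.congr fun n => ?_
    push_cast
    congr 1; ring), Summable.tsum_eq_zero_add (by simpa using hs0)]
  have e1 : ∑' n : ℕ, Real.exp (-Real.pi * t * ((-((n : ℤ) + 1) : ℤ) : ℝ) ^ 2) =
      thetaSum 0 t := tsum_congr fun n => by rw [← e]; push_cast; congr 1; ring
  have e2 : ∑' n : ℕ, Real.exp (-Real.pi * t * (((n + 1 : ℕ) : ℤ) : ℝ) ^ 2) =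
      thetaSum 0 t := tsum_congr fun n => by rw [← e]; push_cast; rfl
  rw [e1, e2]
  simp
  ring

/-- Jacobi's theta function in the variable in which its functional equation is evenness. -/
noncomputable def evenTheta (u : ℝ) : ℝ := Real.exp u * (1 + 2 * thetaSum 0 (Real.exp (4 * u)))

/-- Jacobi's functional equation at `exp (4 * u)`: the square root `exp (2 * u)` is shared equally
between `u` and `-u` by the prefactor `exp u`. -/
lemma evenTheta_neg (u : ℝ) : evenTheta (-u) = evenTheta u := by
  have h := Real.tsum_exp_neg_mul_int_sq (Real.exp_pos (4 * u))
  have e : ∀ n : ℤ, Real.exp (-Real.pi / Real.exp (4 * u) * (n : ℝ) ^ 2) =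
      Real.exp (-Real.pi * Real.exp (4 * -u) * (n : ℝ) ^ 2) := fun n => by
    rw [mul_neg, Real.exp_neg (4 * u), div_eq_mul_inv]
  simp only [e] at h
  rw [tsum_int_exp_eq (Real.exp_pos _), tsum_int_exp_eq (Real.exp_pos _), ← Real.exp_mul] at h
  rw [evenTheta, evenTheta, h, show 4 * u * (1 / 2) = u + u by ring, Real.exp_add, Real.exp_neg]
  field_simp

lemma hasDerivAt_exp_const_mul (c u : ℝ) :
    HasDerivAt (fun u => Real.exp (c * u)) (c * Real.exp (c * u)) u := by
  have := ((hasDerivAt_id u).const_mul c).exp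
  refine this.congr_deriv ?_
  simp only [id, mul_one]; ring

lemma hasDerivAt_exp_mul_thetaSum (c : ℝ) (j : ℕ) (u : ℝ) :
    HasDerivAt (fun u => Real.exp (c * u) * thetaSum j (Real.exp (4 * u)))
      (c * (Real.exp (c * u) * thetaSum j (Real.exp (4 * u))) -
        4 * (Real.exp ((c + 4) * u) * thetaSum (j + 1) (Real.exp (4 * u)))) u := by
  have h := (hasDerivAt_thetaSum j (Real.exp_pos (4 * u))).comp u (hasDerivAt_exp_const_mul 4 u)
  refine ((hasDerivAt_exp_const_mul c u).mul h).congr_deriv ?_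
  rw [add_mul, Real.exp_add]
  simp only [Function.comp_apply]
  ring

lemma Phi_eq (u : ℝ) : Phi u = 2 * (Real.exp (9 * u) * thetaSum 2 (Real.exp (4 * u))) -
    3 * (Real.exp (5 * u) * thetaSum 1 (Real.exp (4 * u))) := by
  have h2 := (summable_thetaSum 2 (Real.exp_pos (4 * u))).mul_left (2 * Real.exp (9 * u))
  have h1 := (summable_thetaSum 1 (Real.exp_pos (4 * u))).mul_left (3 * Real.exp (5 * u))
  rw [← mul_assoc, ← mul_assoc, thetaSum, thetaSum, ← tsum_mul_left, ← tsum_mul_left,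
    ← h2.tsum_sub h1, Phi]
  refine tsum_congr fun n => ?_
  rw [thetaFreq, ← neg_mul]
  ring

/-- The derivative of `evenTheta`. -/
noncomputable def evenThetaDeriv (u : ℝ) : ℝ :=
  evenTheta u - 8 * (Real.exp (5 * u) * thetaSum 1 (Real.exp (4 * u)))

lemma hasDerivAt_evenTheta (u : ℝ) : HasDerivAt evenTheta (evenThetaDeriv u) u := by
  have h := (hasDerivAt_exp_const_mul 1 u).add
    ((hasDerivAt_exp_mul_thetaSum 1 0 u).const_mul 2)
  have e : evenTheta = (fun u => Real.exp (1 * u)) +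
      fun u => 2 * (Real.exp (1 * u) * thetaSum 0 (Real.exp (4 * u))) := by
    ext u; simp only [evenTheta, Pi.add_apply, one_mul]; ring
  rw [e]
  refine h.congr_deriv ?_
  simp only [evenThetaDeriv, evenTheta]
  norm_num
  ring

lemma hasDerivAt_evenThetaDeriv (u : ℝ) :
    HasDerivAt evenThetaDeriv (evenTheta u + 16 * Phi u) u := by
  refine ((hasDerivAt_evenTheta u).sub
    ((hasDerivAt_exp_mul_thetaSum 5 1 u).const_mul 8)).congr_deriv ?_
  rw [Phi_eq, evenThetaDeriv]
  norm_num
  ring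

lemma evenThetaDeriv_neg (u : ℝ) : evenThetaDeriv (-u) = -evenThetaDeriv u := by
  have h := (hasDerivAt_evenTheta (-u)).comp u (hasDerivAt_neg u)
  rw [show evenTheta ∘ Neg.neg = evenTheta from funext evenTheta_neg] at h
  linarith [h.unique (hasDerivAt_evenTheta u)]

/-- `16 * Phi` is the second derivative of `evenTheta` minus `evenTheta` itself, and both are even.
-/
lemma Phi_neg (u : ℝ) : Phi (-u) = Phi u := by
  have h := ((hasDerivAt_evenThetaDeriv (-u)).comp u (hasDerivAt_neg u)).neg
  have e : -(evenThetaDeriv ∘ Neg.neg) = evenThetaDeriv := by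
    ext v; simp [evenThetaDeriv_neg]
  rw [e] at h
  have := h.unique (hasDerivAt_evenThetaDeriv u)
  rw [evenTheta_neg] at this
  linarith

lemma continuous_Phi : Continuous Phi := by
  have e : Phi = fun u => 2 * (Real.exp (9 * u) * thetaSum 2 (Real.exp (4 * u))) -
    3 * (Real.exp (5 * u) * thetaSum 1 (Real.exp (4 * u))) := funext Phi_eq
  rw [e, continuous_iff_continuousAt]
  intro u
  exact ((hasDerivAt_exp_mul_thetaSum 9 2 u).continuousAt.const_mul 2).sub
    ((hasDerivAt_exp_mul_thetaSum 5 1 u).continuousAt.const_mul 3)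

lemma Phi_pos {u : ℝ} (hu : 0 < u) : 0 < Phi u := by
  have h2 := (summable_thetaSum 2 (Real.exp_pos (4 * u))).mul_left (2 * Real.exp (9 * u))
  have h1 := (summable_thetaSum 1 (Real.exp_pos (4 * u))).mul_left (3 * Real.exp (5 * u))
  have e := Phi_eq u
  rw [← mul_assoc, ← mul_assoc, thetaSum, thetaSum, ← tsum_mul_left, ← tsum_mul_left,
    ← h2.tsum_sub h1] at e
  rw [e]
  have hterm : ∀ n, 0 < 2 * Real.exp (9 * u) * (thetaFreq n ^ 2 *
      Real.exp (-thetaFreq n * Real.exp (4 * u))) - 3 * Real.exp (5 * u) * (thetaFreq n ^ 1 *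
      Real.exp (-thetaFreq n * Real.exp (4 * u))) := by
    intro n
    have hp := thetaFreq_pos n
    have h3 : 3 < 2 * thetaFreq n * Real.exp (4 * u) := by
      have := pi_le_thetaFreq n
      have := Real.pi_gt_three
      have := Real.one_lt_exp_iff.2 (show 0 < 4 * u by linarith)
      nlinarith
    have : 0 < Real.exp (5 * u) * thetaFreq n * Real.exp (-thetaFreq n * Real.exp (4 * u)) *
        (2 * thetaFreq n * Real.exp (4 * u) - 3) :=
      mul_pos (by positivity) (by linarith)
    rw [show 9 * u = 5 * u + 4 * u by ring, Real.exp_add]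
    linarith
  exact (h2.sub h1).tsum_pos (fun n => (hterm n).le) 0 (hterm 0)

lemma thetaSum_le (j : ℕ) {t : ℝ} (ht : 1 ≤ t) :
    thetaSum j t ≤ thetaSum j 1 * Real.exp (-Real.pi * (t - 1)) := by
  rw [thetaSum, thetaSum, ← tsum_mul_right]
  refine (summable_thetaSum j (by linarith)).tsum_le_tsum (fun n => ?_)
    ((summable_thetaSum j one_pos).mul_right _)
  have hp := thetaFreq_pos n
  rw [mul_assoc, ← Real.exp_add]
  gcongr _ * Real.exp ?_
  nlinarith [pi_le_thetaFreq n]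

/-- In `10 * u`, the part `9 * u` comes from the leading term of `Phi`, and the extra `u` leaves an
integrable `exp (-u)`. A cubic lower bound for the exponential dominates the quadratic. -/
lemma quadratic_sub_exp_le (c : ℝ) {u : ℝ} (hu : 0 ≤ u) :
    10 * u + c * u ^ 2 - Real.pi * Real.exp (4 * u) ≤ 16 + |c| ^ 3 := by
  have h1 : 10 * u ^ 3 ≤ Real.exp (4 * u) := by
    have := Real.pow_div_factorial_le_exp (4 * u) (by linarith) 3
    norm_num [Nat.factorial] at this
    nlinarith [pow_nonneg hu 3]
  have h2 : 10 * u ≤ u ^ 3 + 16 := by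
    nlinarith [mul_nonneg (sq_nonneg (u - 2)) (add_nonneg hu zero_le_four)]
  have h3 : c * u ^ 2 ≤ u ^ 3 + |c| ^ 3 := by
    have hc := le_abs_self c
    have hc0 := abs_nonneg c
    have : c * u ^ 2 ≤ |c| * u ^ 2 := by gcongr
    rcases le_total u |c| with h | h
    · have : |c| * u ^ 2 ≤ |c| * |c| ^ 2 := by gcongr
      nlinarith [pow_nonneg hu 3]
    · have : |c| * u ^ 2 ≤ u * u ^ 2 := by gcongr
      nlinarith [pow_nonneg hc0 3]
  have h4 : Real.exp (4 * u) ≤ Real.pi * Real.exp (4 * u) := by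
    nlinarith [Real.pi_gt_three, Real.exp_pos (4 * u)]
  nlinarith [pow_nonneg hu 3]

theorem rapidKernel_Phi : RapidKernel Phi := by
  refine ⟨fun u hu => Phi_pos hu, fun c => ?_⟩
  have hint : IntegrableOn (fun u : ℝ =>
      2 * thetaSum 2 1 * Real.exp Real.pi * Real.exp (16 + |c| ^ 3) * Real.exp (-1 * u)) (Ioi 0) :=
    (exp_neg_integrableOn_Ioi 0 one_pos).const_mul _
  refine Integrable.mono' hint (Continuous.aestronglyMeasurable
    (continuous_Phi.mul (by fun_prop))) ?_
  filter_upwards [ae_restrict_mem measurableSet_Ioi] with u hu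
  have hu : 0 < u := hu
  rw [Real.norm_of_nonneg (mul_pos (Phi_pos hu) (Real.exp_pos _)).le]
  have h1 : Phi u ≤ 2 * (Real.exp (9 * u) *
      (thetaSum 2 1 * Real.exp (-Real.pi * (Real.exp (4 * u) - 1)))) := by
    rw [Phi_eq]
    have h1 := thetaSum_pos 1 (Real.exp_pos (4 * u))
    have h2 := thetaSum_le 2 (Real.one_le_exp (show 0 ≤ 4 * u by linarith))
    have h3 : 0 < Real.exp (5 * u) * thetaSum 1 (Real.exp (4 * u)) := by positivity
    have h4 := mul_le_mul_of_nonneg_left h2 (Real.exp_pos (9 * u)).le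
    linarith
  have hT := thetaSum_pos 2 one_pos
  calc Phi u * Real.exp (c * u ^ 2)
      ≤ 2 * (Real.exp (9 * u) * (thetaSum 2 1 * Real.exp (-Real.pi * (Real.exp (4 * u) - 1)))) *
        Real.exp (c * u ^ 2) := by gcongr
    _ = 2 * thetaSum 2 1 * Real.exp Real.pi *
        Real.exp (10 * u + c * u ^ 2 - Real.pi * Real.exp (4 * u)) * Real.exp (-1 * u) := by
        rw [show -Real.pi * (Real.exp (4 * u) - 1) = Real.pi + -(Real.pi * Real.exp (4 * u)) by ring,
          show 10 * u + c * u ^ 2 - Real.pi * Real.exp (4 * u) =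
            9 * u + c * u ^ 2 + -(Real.pi * Real.exp (4 * u)) + u by ring]
        simp only [Real.exp_add, neg_one_mul, Real.exp_neg u]
        field_simp
    _ ≤ _ := by gcongr; exact quadratic_sub_exp_le c hu.le

/-! ### Mellin transforms and Riemann's formula -/

lemma H_eq_cosTransform (t : ℝ) (z : ℂ) :
    H t z = cosTransform (fun u => Phi u * Real.exp (t * u ^ 2)) z := by
  simp only [H, cosTransform, mul_comm (Phi _)]

lemma summable_thetaFreq_rpow {j : ℕ} {σ : ℝ} (hσ : j + 1 / 2 < σ) :
    Summable fun n : ℕ => ‖((thetaFreq n ^ j : ℝ) : ℂ)‖ / thetaFreq n ^ σ := by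
  have h := (Real.summable_nat_rpow.2 (show 2 * (j - σ) < -1 by linarith)).comp_injective
    (add_left_injective 1)
  refine (h.mul_left (Real.pi ^ ((j : ℝ) - σ))).congr fun n => ?_
  have hp := thetaFreq_pos n
  have hn : (0 : ℝ) < (n : ℝ) + 1 := by positivity
  rw [Complex.norm_real, Real.norm_of_nonneg (by positivity), ← Real.rpow_natCast (thetaFreq n),
    ← Real.rpow_sub hp, thetaFreq, Real.mul_rpow Real.pi_pos.le (by positivity),
    ← Real.rpow_natCast, ← Real.rpow_mul hn.le]
  simp

lemma hasSum_mellin_thetaSum {j : ℕ} {w : ℂ} (hw : j + 1 / 2 < w.re) :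
    HasSum (fun n : ℕ => Complex.Gamma w * ((thetaFreq n ^ j : ℝ) : ℂ) / (thetaFreq n : ℂ) ^ w)
      (mellin (fun t => ((thetaSum j t : ℝ) : ℂ)) w) := by
  refine hasSum_mellin (fun n => Or.inr (thetaFreq_pos n))
    (lt_trans (by positivity) hw) (fun t ht => ?_) (summable_thetaFreq_rpow hw)
  exact_mod_cast (summable_thetaSum j ht).hasSum

lemma mellinConvergent_thetaSum {j : ℕ} {w : ℂ} (hw : j + 1 / 2 < w.re) :
    MellinConvergent (fun t => ((thetaSum j t : ℝ) : ℂ)) w := by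
  have hmeas : AEStronglyMeasurable (fun t => ((thetaSum j t : ℝ) : ℂ))
      (volume.restrict (Ioi 0)) :=
    (Complex.continuous_ofReal.comp_continuousOn (continuousOn_thetaSum j)).aestronglyMeasurable
      measurableSet_Ioi
  suffices h : MellinConvergent (fun t => ((thetaSum j t : ℝ) : ℂ)) (w.re : ℂ) by
    rw [MellinConvergent, mellin_convergent_iff_norm Subset.rfl measurableSet_Ioi hmeas] at h ⊢
    simpa using h
  by_contra hdiv
  -- A divergent integral has the default value `0`, whereas termwise integration evaluates it as a
  -- sum of positive terms.
  have h0 : mellin (fun t => ((thetaSum j t : ℝ) : ℂ)) (w.re : ℂ) = 0 := integral_undef hdiv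
  have hs := hasSum_mellin_thetaSum (j := j) (w := (w.re : ℂ)) (by simpa using hw)
  rw [h0] at hs
  have hw0 : 0 < w.re := lt_trans (by positivity) hw
  have e : ∀ n : ℕ, Complex.Gamma (w.re : ℂ) * ((thetaFreq n ^ j : ℝ) : ℂ) /
      (thetaFreq n : ℂ) ^ (w.re : ℂ) =
      ((Real.Gamma w.re * thetaFreq n ^ j / thetaFreq n ^ w.re : ℝ) : ℂ) := fun n => by
    rw [Complex.ofReal_div, Complex.ofReal_mul, ← Complex.Gamma_ofReal,
      Complex.ofReal_cpow (thetaFreq_pos n).le]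
  simp only [e] at hs
  have hs' : HasSum (fun n : ℕ => Real.Gamma w.re * thetaFreq n ^ j / thetaFreq n ^ w.re) 0 :=
    Complex.hasSum_ofReal.1 (by simpa only [Complex.ofReal_zero] using hs)
  have hpos : ∀ n : ℕ, 0 < Real.Gamma w.re * thetaFreq n ^ j / thetaFreq n ^ w.re := fun n => by
    have := thetaFreq_pos n
    have := Real.Gamma_pos_of_pos hw0
    positivity
  have := hs'.summable.tsum_pos (fun n => (hpos n).le) 0 (hpos 0)
  rw [hs'.tsum_eq] at this
  exact this.false

/-- The shift by `j` cancels the weight `thetaFreq n ^ j`, so every `j` yields the same Dirichlet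
series and only the Gamma factor changes. -/
lemma mellin_thetaSum (j : ℕ) {s : ℂ} (hs : 1 < s.re) :
    mellin (fun t => ((thetaSum j t : ℝ) : ℂ)) (s / 2 + j) =
      Complex.Gamma (s / 2 + j) * ((Real.pi : ℂ) ^ (-s / 2) * riemannZeta s) := by
  have hw : j + 1 / 2 < (s / 2 + j).re := by simp; linarith
  rw [← (hasSum_mellin_thetaSum hw).tsum_eq, zeta_eq_tsum_one_div_nat_add_one_cpow hs,
    ← tsum_mul_left, ← tsum_mul_left]
  refine tsum_congr fun n => ?_
  have hp := thetaFreq_pos n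
  have hp' : (thetaFreq n : ℂ) ≠ 0 := by exact_mod_cast hp.ne'
  have hn : (0 : ℝ) < (n : ℝ) + 1 := by positivity
  have e : (thetaFreq n : ℂ) ^ (s / 2) = (Real.pi : ℂ) ^ (s / 2) * ((n : ℂ) + 1) ^ s := by
    rw [thetaFreq, Complex.ofReal_mul,
      Complex.mul_cpow_ofReal_nonneg Real.pi_pos.le (by positivity)]
    congr 1
    rw [Complex.ofReal_pow, ← Complex.cpow_nat_mul']
    · push_cast; congr 1; ring
    all_goals rw [Complex.arg_ofReal_of_nonneg hn.le]; simp [Real.pi_pos, Real.pi_pos.le]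
  have hpi : (Real.pi : ℂ) ≠ 0 := by exact_mod_cast Real.pi_ne_zero
  rw [Complex.cpow_add _ _ hp', Complex.cpow_natCast, e, neg_div, Complex.cpow_neg]
  push_cast
  field_simp

lemma ofReal_exp_cpow (x : ℝ) (w : ℂ) :
    ((Real.exp x : ℝ) : ℂ) ^ w = Complex.exp (x * w) := by
  rw [Complex.cpow_def_of_ne_zero (by exact_mod_cast (Real.exp_pos x).ne'), ← Complex.ofReal_log
    (Real.exp_pos x).le, Real.log_exp]

lemma image_exp_four_mul : (fun u : ℝ => Real.exp (4 * u)) '' univ = Ioi 0 := by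
  ext t
  simp only [image_univ, mem_range, mem_Ioi]
  refine ⟨fun ⟨u, hu⟩ => hu ▸ Real.exp_pos _, fun ht => ⟨Real.log t / 4, ?_⟩⟩
  rw [mul_div_cancel₀ _ (by norm_num), Real.exp_log ht]

lemma abs_deriv_smul_mellin_integrand (f : ℝ → ℂ) (w : ℂ) (u : ℝ) :
    |4 * Real.exp (4 * u)| • (((Real.exp (4 * u) : ℝ) : ℂ) ^ (w - 1) • f (Real.exp (4 * u))) =
      4 * (Complex.exp (4 * u * w) * f (Real.exp (4 * u))) := by
  rw [abs_of_pos (by positivity), ofReal_exp_cpow, Complex.real_smul, smul_eq_mul]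
  have : Complex.exp (4 * u * w) =
      ((Real.exp (4 * u) : ℝ) : ℂ) * Complex.exp ((4 * u : ℝ) * (w - 1)) := by
    rw [Complex.ofReal_exp, ← Complex.exp_add]; congr 1; push_cast; ring
  rw [this]
  push_cast
  ring

lemma mellin_eq_integral_exp (f : ℝ → ℂ) (w : ℂ) :
    mellin f w = ∫ u : ℝ, 4 * (Complex.exp (4 * u * w) * f (Real.exp (4 * u))) := by
  rw [mellin, ← image_exp_four_mul, integral_image_eq_integral_abs_deriv_smul MeasurableSet.univ
    (fun u _ => (hasDerivAt_exp_const_mul 4 u).hasDerivWithinAt)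
    (fun u _ v _ h => by simpa using h), setIntegral_univ]
  simp only [abs_deriv_smul_mellin_integrand]

lemma mellinConvergent_iff_integrable_exp (f : ℝ → ℂ) (w : ℂ) :
    MellinConvergent f w ↔
      Integrable fun u : ℝ => 4 * (Complex.exp (4 * u * w) * f (Real.exp (4 * u))) := by
  rw [MellinConvergent, ← image_exp_four_mul, integrableOn_image_iff_integrableOn_abs_deriv_smul
    MeasurableSet.univ (fun u _ => (hasDerivAt_exp_const_mul 4 u).hasDerivWithinAt)
    (fun u _ v _ h => by simpa using h), integrableOn_univ]
  simp only [abs_deriv_smul_mellin_integrand]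

lemma Phi_mul_exp_eq (z : ℂ) (u : ℝ) :
    ((Phi u : ℝ) : ℂ) * Complex.exp (Complex.I * z * u) =
      1 / 2 * (4 * (Complex.exp (4 * u * ((1 + Complex.I * z) / 2 / 2 + (2 : ℕ))) *
        ((thetaSum 2 (Real.exp (4 * u)) : ℝ) : ℂ))) -
      3 / 4 * (4 * (Complex.exp (4 * u * ((1 + Complex.I * z) / 2 / 2 + (1 : ℕ))) *
        ((thetaSum 1 (Real.exp (4 * u)) : ℝ) : ℂ))) := by
  have e2 : Complex.exp (4 * u * ((1 + Complex.I * z) / 2 / 2 + (2 : ℕ))) =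
      ((Real.exp (9 * u) : ℝ) : ℂ) * Complex.exp (Complex.I * z * u) := by
    rw [Complex.ofReal_exp, ← Complex.exp_add]; congr 1; push_cast; ring
  have e1 : Complex.exp (4 * u * ((1 + Complex.I * z) / 2 / 2 + (1 : ℕ))) =
      ((Real.exp (5 * u) : ℝ) : ℂ) * Complex.exp (Complex.I * z * u) := by
    rw [Complex.ofReal_exp, ← Complex.exp_add]; congr 1; push_cast; ring
  rw [e1, e2, Phi_eq]
  push_cast
  ring

/-- With `s = (1 + i z) / 2` and `t = exp (4 * u)`, the two terms of `Phi` become Mellin transforms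
at `s / 2 + 2` and `s / 2 + 1`. The Gamma recursion combines them into `s * (s - 1) / 8`; the
condition on `z` says `1 < re s`. -/
lemma integral_Phi_mul_exp {z : ℂ} (hz : z.im < -1) :
    Integrable (fun u : ℝ => ((Phi u : ℝ) : ℂ) * Complex.exp (Complex.I * z * u)) ∧
    ∫ u : ℝ, ((Phi u : ℝ) : ℂ) * Complex.exp (Complex.I * z * u) =
      (1 + Complex.I * z) / 2 * ((1 + Complex.I * z) / 2 - 1) / 8 *
        completedRiemannZeta ((1 + Complex.I * z) / 2) := by
  set s : ℂ := (1 + Complex.I * z) / 2 with hs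
  have hsre : 1 < s.re := by
    rw [hs, show (1 + Complex.I * z) / 2 = ((1 / 2 : ℝ) : ℂ) * (1 + Complex.I * z) by
      push_cast; ring, Complex.re_ofReal_mul]
    simp; linarith
  have hc : ∀ j : ℕ, MellinConvergent (fun t => ((thetaSum j t : ℝ) : ℂ)) (s / 2 + j) :=
    fun j => mellinConvergent_thetaSum (by simp; linarith)
  have i2 := (mellinConvergent_iff_integrable_exp _ _).1 (hc 2)
  have i1 := (mellinConvergent_iff_integrable_exp _ _).1 (hc 1)
  simp only [Phi_mul_exp_eq]
  refine ⟨(i2.const_mul _).sub (i1.const_mul _), ?_⟩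
  rw [integral_sub (i2.const_mul _) (i1.const_mul _), integral_const_mul (1 / 2 : ℂ),
    integral_const_mul (3 / 4 : ℂ), ← mellin_eq_integral_exp (fun t => ((thetaSum 2 t : ℝ) : ℂ)),
    ← mellin_eq_integral_exp (fun t => ((thetaSum 1 t : ℝ) : ℂ)),
    mellin_thetaSum 2 hsre, mellin_thetaSum 1 hsre]
  have hs0 : s ≠ 0 := Complex.ne_zero_of_one_lt_re hsre
  have hs1 : s / 2 + 1 ≠ 0 := fun h => by
    have := congrArg Complex.re h
    simp at this
    linarith
  have g1 : Complex.Gamma (s / 2 + (1 : ℕ)) = s / 2 * Complex.Gamma (s / 2) := by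
    rw [Nat.cast_one, Complex.Gamma_add_one _ (div_ne_zero hs0 two_ne_zero)]
  have g2 : Complex.Gamma (s / 2 + (2 : ℕ)) = (s / 2 + 1) * (s / 2 * Complex.Gamma (s / 2)) := by
    rw [show s / 2 + ((2 : ℕ) : ℂ) = s / 2 + 1 + 1 by push_cast; ring,
      Complex.Gamma_add_one _ hs1, Complex.Gamma_add_one _ (div_ne_zero hs0 two_ne_zero)]
  rw [g1, g2, completedZeta_eq_tsum_of_one_lt_re hsre, zeta_eq_tsum_one_div_nat_cpow hsre]
  ring

lemma cosTransform_Phi_eq_of_im_lt {z : ℂ} (hz : z.im < -1) :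
    2 * cosTransform Phi z =
      (1 + Complex.I * z) / 2 * ((1 + Complex.I * z) / 2 - 1) / 8 *
        completedRiemannZeta ((1 + Complex.I * z) / 2) := by
  obtain ⟨hint, hval⟩ := integral_Phi_mul_exp hz
  rw [← hval, ← intervalIntegral.integral_Iic_add_Ioi (b := 0) hint.integrableOn hint.integrableOn,
    ← neg_zero, ← integral_comp_neg_Ioi, neg_zero, cosTransform, ← integral_const_mul,
    ← integral_add]
  · refine integral_congr_ae (Eventually.of_forall fun u => ?_)
    simp only [Phi_neg, Complex.cos]
    rw [show Complex.I * z * ((-u : ℝ) : ℂ) = -(z * u) * Complex.I by push_cast; ring,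
      show Complex.I * z * u = z * u * Complex.I by ring]
    ring
  · exact hint.comp_neg.integrableOn
  · exact hint.integrableOn

/-- Riemann's formula: `H_0` is the completed zeta function on the critical line. -/
theorem cosTransform_Phi_eq (z : ℂ) :
    16 * cosTransform Phi z = (1 + Complex.I * z) / 2 * ((1 + Complex.I * z) / 2 - 1) *
      completedRiemannZeta₀ ((1 + Complex.I * z) / 2) + 1 := by
  have hL : AnalyticOnNhd ℂ (fun z => 16 * cosTransform Phi z) univ := fun z _ =>
    (rapidKernel_Phi.differentiable_cosTransform.const_mul 16).analyticAt z
  have hΛ := differentiable_completedZeta₀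
  have hR : AnalyticOnNhd ℂ (fun z => (1 + Complex.I * z) / 2 * ((1 + Complex.I * z) / 2 - 1) *
      completedRiemannZeta₀ ((1 + Complex.I * z) / 2) + 1) univ := fun z _ =>
    Differentiable.analyticAt (by fun_prop) z
  refine hL.eqOn_of_preconnected_of_eventuallyEq hR isPreconnected_univ
    (mem_univ (-2 * Complex.I)) ?_ (mem_univ z)
  have hopen : IsOpen {z : ℂ | z.im < -1} := isOpen_lt (by fun_prop) (by fun_prop)
  filter_upwards [hopen.mem_nhds (show -2 * Complex.I ∈ {z : ℂ | z.im < -1} by norm_num)] with z hz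
  have h := cosTransform_Phi_eq_of_im_lt hz
  have hz' : z.im < -1 := hz
  have hs0 : (1 + Complex.I * z) / 2 ≠ 0 := fun h => by
    have := congrArg Complex.re h
    simp at this
    linarith
  have hs1 : 1 - (1 + Complex.I * z) / 2 ≠ 0 := fun h => by
    have := congrArg Complex.re h
    simp at this
    linarith
  rw [completedRiemannZeta_eq] at h
  generalize (1 + Complex.I * z) / 2 = s at *
  have : 16 * cosTransform Phi z = 8 * (2 * cosTransform Phi z) := by ring
  rw [this, h]
  field_simp
  ring

/-- Riemann's formula is applied at the conjugate zero, which sends `b` to real part `(1 + b) / 2`.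
Its right side equals `1` at `s = 0` and `s = 1`, so these points are excluded automatically. -/
lemma riemannZeta_eq_zero_of_cosTransform_Phi {a b : ℝ}
    (h : cosTransform Phi (a + b * Complex.I) = 0) :
    riemannZeta (((1 + b) / 2 : ℝ) + ((a / 2 : ℝ) : ℂ) * Complex.I) = 0 := by
  have h1 := cosTransform_conj_eq_zero h
  have h2 := cosTransform_Phi_eq (a + (-b : ℝ) * Complex.I)
  have e : (1 + Complex.I * (a + (-b : ℝ) * Complex.I)) / 2 =
      ((1 + b) / 2 : ℝ) + ((a / 2 : ℝ) : ℂ) * Complex.I := by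
    push_cast
    linear_combination (-(b : ℂ) / 2) * Complex.I_sq
  rw [h1, mul_zero, e] at h2
  generalize ((((1 + b) / 2 : ℝ) : ℂ) + ((a / 2 : ℝ) : ℂ) * Complex.I) = s at h2 ⊢
  have hs0 : s ≠ 0 := by rintro rfl; simp at h2
  have hs1 : 1 - s ≠ 0 := fun h => by
    rw [← sub_eq_zero.1 h] at h2; simp at h2
  rw [riemannZeta_def_of_ne_zero hs0, completedRiemannZeta_eq, div_eq_zero_iff]
  left
  field_simp
  linear_combination h2

/-! ### The barrier argument -/

/-- Propagation of a zero-free region along the discrete heat flow behind a zero-free barrier. -/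
lemma sq_im_le_of_barrier {K : ℝ → ℝ} (hK : RapidKernel K) {l X w Y : ℝ} {N : ℕ} (hl : 0 < l)
    (hw : 0 ≤ w) (hwY : 1 ≤ w ^ 2 + Y) (hY : 0 ≤ Y - N * l ^ 2)
    (hstrip : ∀ a b : ℝ, cosTransform K (a + b * Complex.I) = 0 → b ^ 2 ≤ 1)
    (hinit : ∀ a b : ℝ, |a| ≤ X → cosTransform K (a + b * Complex.I) = 0 → b ^ 2 ≤ Y)
    (hbarrier : ∀ k ≤ N, ∀ a b : ℝ, X ≤ a → a ≤ X + w → 0 ≤ b → Y - k * l ^ 2 ≤ b ^ 2 →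
      b ^ 2 ≤ 1 - k * l ^ 2 →
      cosTransform (fun u => K u * Real.cosh (l * u) ^ k) (a + b * Complex.I) ≠ 0)
    {k : ℕ} (hk : k ≤ N) : ∀ a b : ℝ, |a| ≤ X + w →
      cosTransform (fun u => K u * Real.cosh (l * u) ^ k) (a + b * Complex.I) = 0 →
      b ^ 2 ≤ Y - k * l ^ 2 := by
  have hYk : ∀ k ≤ N, 0 ≤ Y - k * l ^ 2 := fun k hk => by
    have : (k : ℝ) * l ^ 2 ≤ N * l ^ 2 := by gcongr
    linarith
  have hdB : ∀ (k : ℕ) (a b : ℝ),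
      cosTransform (fun u => K u * Real.cosh (l * u) ^ k) (a + b * Complex.I) = 0 →
      b ^ 2 ≤ max (1 - k * l ^ 2) 0 :=
    sq_im_le_of_cosh_pow hK hl (fun a b h => (hstrip a b h).trans (le_max_left _ _))
  have hext : ∀ k ≤ N, (∀ a b : ℝ, |a| ≤ X →
      cosTransform (fun u => K u * Real.cosh (l * u) ^ k) (a + b * Complex.I) = 0 →
      b ^ 2 ≤ Y - k * l ^ 2) → ∀ a b : ℝ, |a| ≤ X + w →
      cosTransform (fun u => K u * Real.cosh (l * u) ^ k) (a + b * Complex.I) = 0 →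
      b ^ 2 ≤ Y - k * l ^ 2 := by
    intro k hk h a b ha hab
    rcases le_total |a| X with haX | haX
    · exact h a b haX hab
    by_contra! hlt
    have h1 : b ^ 2 ≤ 1 - k * l ^ 2 :=
      (le_max_iff.1 (hdB k a b hab)).resolve_right (by linarith [hYk k hk])
    exact hbarrier k hk |a| |b| haX ha (abs_nonneg b) (by rw [sq_abs]; exact hlt.le)
      (by rwa [sq_abs]) (cosTransform_abs_eq_zero hab)
  induction k with
  | zero => exact hext 0 hk (by simpa using hinit)
  | succ k ih =>
    have ih := ih (Nat.le_of_succ_le hk)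
    refine hext _ hk fun a b ha hab => ?_
    by_contra! hlt
    have hb2 : 0 < b ^ 2 := (hYk _ hk).trans_lt hlt
    have hb : 0 < |b| := abs_pos.2 fun h => by simp [h] at hb2
    have h0 := cosTransform_abs_eq_zero hab
    have hker : (fun u => K u * Real.cosh (l * u) ^ (k + 1)) =
        fun u => (K u * Real.cosh (l * u) ^ k) * Real.cosh (l * u) := by
      ext u; rw [pow_succ, mul_assoc]
    rw [hker] at h0
    refine cosTransform_cosh_ne_zero (hK.mul_cosh_pow l k) hl hb (fun a' b' h' => ?_) h0
    rw [sq_abs]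
    push_cast at hlt
    have hsq := sq_nonneg (|a| - a')
    rcases le_or_gt |a'| (X + w) with ha' | ha'
    · have := ih a' b' ha' h'
      linarith
    -- A zero beyond the barrier is at horizontal distance more than `w`, and `1 ≤ w ^ 2 + Y`
    -- outweighs the global bound `1 - k * l ^ 2`; the `l ^ 2` of the criterion covers the step from
    -- `k` to `k + 1`.
    · refine (hdB k a' b' h').trans_lt (max_lt ?_ (by positivity))
      have h1 : w < |(|a| - a')| := by
        have h2 := abs_sub_abs_le_abs_sub a' |a|
        rw [abs_abs, abs_sub_comm] at h2
        linarith
      have h2 : w ^ 2 < (|a| - a') ^ 2 := by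
        rw [← sq_abs (|a| - a')]
        exact pow_lt_pow_left₀ h1 hw two_ne_zero
      linarith

lemma continuousOn_H (T B : ℝ) :
    ContinuousOn (fun p : ℝ × ℂ => H p.1 p.2) {p | p.1 ≤ T ∧ |p.2.im| ≤ B} := by
  refine continuousOn_of_dominated (bound := fun u => Phi u * Real.exp (T * u ^ 2) *
    Real.exp (B * u)) (fun p _ => ?_) (fun p hp => ?_) ?_ (Eventually.of_forall fun u => ?_)
  · have := continuous_Phi
    exact Continuous.aestronglyMeasurable (by fun_prop)
  · filter_upwards [ae_restrict_mem measurableSet_Ioi] with u hu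
    have hu : 0 < u := hu
    have hP := Phi_pos hu
    rw [norm_mul, Complex.norm_real, Real.norm_of_nonneg (by positivity), mul_comm (Real.exp _)]
    refine mul_le_mul ?_ ((norm_cos_mul_le _ hu).trans (Real.exp_le_exp.2 ?_)) (norm_nonneg _)
      (by positivity)
    · gcongr; exact hp.1
    · gcongr; exact hp.2
  · have h := (rapidKernel_Phi.mul_exp T).integrableOn_smul (g := fun u => Real.exp (B * u))
      (C := Real.exp (B ^ 2)) (c := 1) (by fun_prop) (fun u _ => by
        rw [Real.norm_of_nonneg (Real.exp_pos _).le]; exact exp_mul_le B u)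
    exact h
  · fun_prop

/-- A zero with `|b| > 1` would give a zero of zeta with real part greater than 1. -/
lemma sq_im_le_one_of_cosTransform_Phi {a b : ℝ}
    (h : cosTransform Phi (a + b * Complex.I) = 0) : b ^ 2 ≤ 1 := by
  have h0 := riemannZeta_eq_zero_of_cosTransform_Phi (cosTransform_abs_eq_zero h)
  by_contra! hlt
  refine riemannZeta_ne_zero_of_one_le_re ?_ h0
  have : 1 < |b| := (one_lt_sq_iff_one_lt_abs b).1 hlt
  simp
  linarith

/-- The barrier stays zero-free, uniformly, for the discrete heat flow with small steps. -/
lemma eventually_ne_zero_on_barrier {t₀ X w y₀ : ℝ} (ht₀ : 0 < t₀)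
    (h_barrier : ∀ t x y : ℝ, 0 ≤ t → t ≤ t₀ → X ≤ x → x ≤ X + w →
      Real.sqrt (y₀ ^ 2 + 2 * (t₀ - t)) ≤ y → y ≤ Real.sqrt (1 - 2 * t) →
      H t ((x : ℂ) + (y : ℂ) * Complex.I) ≠ 0) :
    ∀ᶠ n : ℕ in atTop, ∀ k ≤ n + 1, ∀ a b : ℝ, X ≤ a → a ≤ X + w → 0 ≤ b →
      y₀ ^ 2 + 2 * t₀ - k * stepSize t₀ n ^ 2 ≤ b ^ 2 → b ^ 2 ≤ 1 - k * stepSize t₀ n ^ 2 →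
      cosTransform (fun u => Phi u * Real.cosh (stepSize t₀ n * u) ^ k) (a + b * Complex.I)
        ≠ 0 := by
  set S : Set (ℝ × ℂ) := {p | (0 ≤ p.1 ∧ p.1 ≤ t₀) ∧ (X ≤ p.2.re ∧ p.2.re ≤ X + w) ∧ 0 ≤ p.2.im ∧
    y₀ ^ 2 + 2 * (t₀ - p.1) ≤ p.2.im ^ 2 ∧ p.2.im ^ 2 ≤ 1 - 2 * p.1} with hS
  have him : ∀ p ∈ S, p.2.im ≤ 1 := fun p hp => by
    have h1 := hp.1.1
    have h2 := hp.2.2.2.2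
    have h3 := hp.2.2.1
    nlinarith
  have hScompact : IsCompact S := by
    refine IsCompact.of_isClosed_subset
      ((isCompact_Icc (a := (0 : ℝ)) (b := t₀)).prod
        ((isCompact_Icc (a := X) (b := X + w)).reProdIm (isCompact_Icc (a := (0 : ℝ)) (b := 1))))
      ?_ fun p hp => ⟨hp.1, hp.2.1, hp.2.2.1, him p hp⟩
    rw [hS]
    simp only [ofPred_and]
    refine IsClosed.inter (IsClosed.inter ?_ ?_) (IsClosed.inter (IsClosed.inter ?_ ?_)
      (IsClosed.inter ?_ (IsClosed.inter ?_ ?_)))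
    all_goals exact isClosed_le (by fun_prop) (by fun_prop)
  have hSne : ∀ p ∈ S, 0 < ‖H p.1 p.2‖ := fun p hp => by
    rw [norm_pos_iff, ← Complex.re_add_im p.2]
    exact h_barrier _ _ _ hp.1.1 hp.1.2 hp.2.1.1 hp.2.1.2
      (Real.sqrt_le_iff.2 ⟨hp.2.2.1, hp.2.2.2.1⟩) (Real.le_sqrt_of_sq_le hp.2.2.2.2)
  have hcont : ContinuousOn (fun p : ℝ × ℂ => ‖H p.1 p.2‖) S :=
    (continuousOn_H t₀ 1).norm.mono fun p hp =>
      ⟨hp.1.2, by rw [abs_of_nonneg hp.2.2.1]; exact him p hp⟩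
  -- Compactness of the barrier in space and time gives one lower bound for `‖H‖`; a discrete flow
  -- within half of it cannot vanish there.
  obtain ⟨ε, hε, hmin⟩ := hScompact.exists_forall_le' hcont hSne
  filter_upwards [eventually_norm_cosTransform_sub_le rapidKernel_Phi ht₀ 1 (half_pos hε)]
    with n hn k hk a b ha ha' hb hb1 hb2 h0
  have hk' : (k : ℝ) ≤ n + 1 := by exact_mod_cast hk
  have e : (k : ℝ) * stepSize t₀ n ^ 2 = 2 * (k * (t₀ / (n + 1))) := by
    rw [stepSize_sq ht₀.le]; ring
  rw [e] at hb1 hb2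
  have hp : ((k * (t₀ / (n + 1)), (a : ℂ) + b * Complex.I) : ℝ × ℂ) ∈ S := by
    refine ⟨⟨by positivity, ?_⟩, ⟨by simpa using ha, by simpa using ha'⟩, by simpa using hb, ?_, ?_⟩
    · dsimp only
      rw [mul_div_assoc', div_le_iff₀ (by positivity)]; nlinarith
    · simp; linarith
    · simpa using hb2
  have h1 := hn k hk (a + b * Complex.I) (by
    have := him _ hp
    simp at this
    simpa [abs_of_nonneg hb] using this)
  rw [h0, zero_sub, norm_neg, ← H_eq_cosTransform] at h1
  have h2 := hmin _ hp
  dsimp only at h2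
  linarith

/-- Strict inequalities make the region open, as Hurwitz's theorem requires. The closed strip `X ≤
|z.re| ≤ X + w` is left to the barrier hypothesis itself at time `t₀`. -/
lemma H_ne_zero_of_abs_re_lt {t₀ X y₀ : ℝ} (ht₀ : 0 < t₀) (hy₀ : 0 < y₀) (hy₀' : y₀ ≤ 1)
    (h_initial : ∀ σ T : ℝ, (1 + y₀) / 2 ≤ σ → σ ≤ 1 → 0 ≤ T → T ≤ X / 2 →
      riemannZeta ((σ : ℂ) + (T : ℂ) * Complex.I) ≠ 0)
    (h_barrier : ∀ t x y : ℝ, 0 ≤ t → t ≤ t₀ →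
      X ≤ x → x ≤ X + Real.sqrt (1 - y₀ ^ 2) →
      Real.sqrt (y₀ ^ 2 + 2 * (t₀ - t)) ≤ y → y ≤ Real.sqrt (1 - 2 * t) →
      H t ((x : ℂ) + (y : ℂ) * Complex.I) ≠ 0) {z : ℂ} (hre : |z.re| < X)
    (him : y₀ ^ 2 < z.im ^ 2) : H t₀ z ≠ 0 := by
  rw [H_eq_cosTransform]
  refine cosTransform_exp_ne_zero rapidKernel_Phi ht₀
    (U := {z : ℂ | |z.re| < X} ∩ {z : ℂ | y₀ ^ 2 < z.im ^ 2})
    ((isOpen_lt (by fun_prop) (by fun_prop)).inter (isOpen_lt (by fun_prop) (by fun_prop)))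
    ?_ ⟨hre, by simpa using him⟩
  filter_upwards [eventually_ne_zero_on_barrier ht₀ h_barrier] with n hn z hz h0
  have e : ((n + 1 : ℕ) : ℝ) * stepSize t₀ n ^ 2 = 2 * t₀ := by
    rw [stepSize_sq ht₀.le]; push_cast; field_simp
  have hw : Real.sqrt (1 - y₀ ^ 2) ^ 2 = 1 - y₀ ^ 2 := Real.sq_sqrt (by nlinarith)
  have hinit : ∀ a b : ℝ, |a| ≤ X → cosTransform Phi (a + b * Complex.I) = 0 →
      b ^ 2 ≤ y₀ ^ 2 + 2 * t₀ := by
    intro a b ha hab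
    by_contra! hlt
    have hy : y₀ ≤ |b| := abs_le_of_sq_le_sq' (by nlinarith [sq_abs b]) (abs_nonneg b) |>.2
    have hb1 : |b| ≤ 1 := (sq_le_one_iff_abs_le_one b).1 (sq_im_le_one_of_cosTransform_Phi hab)
    exact h_initial ((1 + |b|) / 2) (|a| / 2) (by linarith) (by linarith) (by positivity)
      (by linarith) (riemannZeta_eq_zero_of_cosTransform_Phi (cosTransform_abs_eq_zero hab))
  rw [← Complex.re_add_im z] at h0
  have hzre : |z.re| ≤ X + Real.sqrt (1 - y₀ ^ 2) := by
    have h1 : |z.re| < X := hz.1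
    linarith [Real.sqrt_nonneg (1 - y₀ ^ 2)]
  have h := sq_im_le_of_barrier rapidKernel_Phi (stepSize_pos ht₀ n) (Real.sqrt_nonneg (1 - y₀ ^ 2))
    (X := X) (Y := y₀ ^ 2 + 2 * t₀) (N := n + 1) (by rw [hw]; linarith)
    (by rw [e]; nlinarith) (fun a b => sq_im_le_one_of_cosTransform_Phi) hinit hn le_rfl
    z.re z.im hzre h0
  rw [e] at h
  have := hz.2
  simp at this
  linarith

end DeBruijnNewman

/-! ### The upper bound criterion -/

theorem theorem1p2 (t₀ X y₀ : ℝ) (ht₀ : 0 < t₀) (hX : 0 < X) (hy₀ : 0 < y₀) (hy₀' : y₀ ≤ 1)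
    (h_initial : ∀ σ T : ℝ, (1 + y₀) / 2 ≤ σ → σ ≤ 1 → 0 ≤ T → T ≤ X / 2 →
      riemannZeta ((σ : ℂ) + (T : ℂ) * Complex.I) ≠ 0)
    (h_final : ∀ x y : ℝ, X + Real.sqrt (1 - y₀ ^ 2) ≤ x →
      y₀ ≤ y → y ≤ Real.sqrt (1 - 2 * t₀) →
      DeBruijnNewman.H t₀ ((x : ℂ) + (y : ℂ) * Complex.I) ≠ 0)
    (h_barrier : ∀ t x y : ℝ, 0 ≤ t → t ≤ t₀ →
      X ≤ x → x ≤ X + Real.sqrt (1 - y₀ ^ 2) →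
      Real.sqrt (y₀ ^ 2 + 2 * (t₀ - t)) ≤ y → y ≤ Real.sqrt (1 - 2 * t) →
      DeBruijnNewman.H t ((x : ℂ) + (y : ℂ) * Complex.I) ≠ 0) :
    DeBruijnNewman.Lambda ≤ ((t₀ + y₀ ^ 2 / 2 : ℝ) : EReal) ∧
      ∀ t : ℝ, t₀ + y₀ ^ 2 / 2 ≤ t → DeBruijnNewman.OnlyRealZeros t := by
  open DeBruijnNewman in
  have hstrip : ∀ a b : ℝ,
      cosTransform (fun u => Phi u * Real.exp (t₀ * u ^ 2)) (a + b * Complex.I) = 0 →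
      b ^ 2 ≤ max (y₀ ^ 2) 0 := by
    intro a b hab
    rw [max_eq_left (sq_nonneg _)]
    by_contra! hlt
    have hdB := sq_im_le_of_exp rapidKernel_Phi ht₀.le (D := 1)
      (fun a b h => (sq_im_le_one_of_cosTransform_Phi h).trans (le_max_left _ _)) hab
    have hb : |b| ≤ Real.sqrt (1 - 2 * t₀) := Real.abs_le_sqrt
      ((le_max_iff.1 hdB).resolve_right (by nlinarith))
    have hy : y₀ ≤ |b| := abs_le_of_sq_le_sq' (by nlinarith [sq_abs b]) (abs_nonneg b) |>.2
    have h0 := cosTransform_abs_eq_zero hab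
    rw [← H_eq_cosTransform] at h0
    -- The possible positions of a high zero at time `t₀` are excluded in turn by propagation from
    -- time `0`, by the barrier at `t = t₀`, and by the final hypothesis.
    rcases lt_or_ge |a| X with ha | ha
    · exact H_ne_zero_of_abs_re_lt ht₀ hy₀ hy₀' h_initial h_barrier (by simpa using ha)
        (by simpa using hlt) h0
    rcases le_total |a| (X + Real.sqrt (1 - y₀ ^ 2)) with ha' | ha'
    · exact h_barrier t₀ _ _ ht₀.le le_rfl ha ha'
        (by rwa [sub_self, mul_zero, add_zero, Real.sqrt_sq hy₀.le]) hb h0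
    · exact h_final _ _ ha' hy hb h0
  have hreal : ∀ t : ℝ, t₀ + y₀ ^ 2 / 2 ≤ t → DeBruijnNewman.OnlyRealZeros t := by
    intro t ht z hz
    rw [DeBruijnNewman.H_eq_cosTransform, ← Complex.re_add_im z] at hz
    have hker : (fun u => DeBruijnNewman.Phi u * Real.exp (t * u ^ 2)) = fun u =>
        (DeBruijnNewman.Phi u * Real.exp (t₀ * u ^ 2)) * Real.exp ((t - t₀) * u ^ 2) := by
      ext u; rw [mul_assoc, ← Real.exp_add]; congr 2; ring
    rw [hker] at hz
    -- The flow restarts from time `t₀` with strip bound `y₀ ^ 2`, which is exhausted once `2 * (t -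
    -- t₀) ≥ y₀ ^ 2`.
    have h := DeBruijnNewman.sq_im_le_of_exp (DeBruijnNewman.rapidKernel_Phi.mul_exp t₀)
      (by nlinarith [sq_nonneg y₀]) hstrip hz
    rw [max_eq_right (by linarith)] at h
    exact pow_eq_zero_iff two_ne_zero |>.1 (le_antisymm h (sq_nonneg _))
  exact ⟨sInf_le ⟨_, hreal _ le_rfl, rfl⟩, hreal⟩
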